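/- Let $(R,\mathfrak m,k)$ be a commutative Noetherian local domain, and let $\mathcal D(R)$ be the derived category of $R$-modules. For $X\in\mathcal D(R)$ put $\sup X=\sup\{i\in\mathbb Z\mid H_i(X)\neq 0\}$, $\inf X=\inf\{i\in\mathbb Z\mid H_i(X)\neq 0\}$ (with $\sup\emptyset=-\infty$, $\inf\emptyset=\infty$) and $\operatorname{amp}X=\sup X-\inf X$. For $X$ homologically bounded and $n\in\mathbb Z$, the $n$th Betti number of $X$ is $\beta^R_n(X)=\dim_k H_n(k\otimes^{\mathbf L}_R X)$. A semidualizing complex for $R$ is a homologically bounded $C\in\mathcal D(R)$ with finitely generated homology modules such that the homothety morphism $R\to\mathbf R\mathrm{Hom}_R(C,C)$ is an isomorphism in $\mathcal D(R)$. Theorem. Let $C$ be a semidualizing complex for $R$ such that $\beta^R_{\sup C}(C)=2$. Then $\operatorname{amp}C=0$; that is, $C\simeq\Sigma^{n}M$ in $\mathcal D(R)$ for $n=\sup C$ and some $R$-module $M$. -/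

import Mathlib

universe w u

noncomputable section

namespace SemidualizingComplex

open CategoryTheory CochainComplex.HomComplex

/-! ### Homology, supremum, infimum, amplitude

Mathlib indexes complexes cohomologically: the homological degree `i` is the cohomological
degree `-i`. -/

/-- The homology module `H_i(X) = H^{-i}(X)` of an object `X` of the derived category `D(R)`. -/
abbrev homol (R : Type u) [CommRing R] [HasDerivedCategory.{w} (ModuleCat.{u} R)]
    (X : DerivedCategory (ModuleCat.{u} R)) (i : ℤ) : ModuleCat.{u} R :=
  (DerivedCategory.homologyFunctor (ModuleCat.{u} R) (-i)).obj X

/-- `sup X = sup {i ∈ ℤ | H_i(X) ≠ 0}`, with `sup ∅ = -∞`. -/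
def homolSup (R : Type u) [CommRing R] [HasDerivedCategory.{w} (ModuleCat.{u} R)]
    (X : DerivedCategory (ModuleCat.{u} R)) : EReal :=
  sSup {x : EReal | ∃ i : ℤ, Nontrivial (homol R X i) ∧ x = ((i : ℝ) : EReal)}

/-- `inf X = inf {i ∈ ℤ | H_i(X) ≠ 0}`, with `inf ∅ = ∞`. -/
def homolInf (R : Type u) [CommRing R] [HasDerivedCategory.{w} (ModuleCat.{u} R)]
    (X : DerivedCategory (ModuleCat.{u} R)) : EReal :=
  sInf {x : EReal | ∃ i : ℤ, Nontrivial (homol R X i) ∧ x = ((i : ℝ) : EReal)}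

/-- The amplitude `amp X = sup X - inf X`. -/
def amp (R : Type u) [CommRing R] [HasDerivedCategory.{w} (ModuleCat.{u} R)]
    (X : DerivedCategory (ModuleCat.{u} R)) : EReal :=
  homolSup R X - homolInf R X

/-- `X` is homologically bounded: `H_i(X) = 0` outside a bounded range of degrees. -/
def IsHomologicallyBounded (R : Type u) [CommRing R] [HasDerivedCategory.{w} (ModuleCat.{u} R)]
    (X : DerivedCategory (ModuleCat.{u} R)) : Prop :=
  ∃ a b : ℤ, ∀ i : ℤ, i < a ∨ b < i → Subsingleton (homol R X i)

/-! ### K-projective resolutions -/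

/-- A K-projective resolution of an object `X` of `D(R)`: a K-projective complex of `R`-modules
with an isomorphism to `X` in `D(R)`. (It is unique up to homotopy equivalence, and the derived
functors `RHom(X, -)` and `- ⊗ᴸ X` are computed by it.) -/
structure KProjectiveResolution (R : Type u) [CommRing R]
    [HasDerivedCategory.{w} (ModuleCat.{u} R)] (X : DerivedCategory (ModuleCat.{u} R)) where
  /-- the resolving complex -/
  cx : CochainComplex (ModuleCat.{u} R) ℤ
  isKProjective : cx.IsKProjective
  /-- the isomorphism in `D(R)` -/
  iso : DerivedCategory.Q.obj cx ≅ X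

open Opposite in
theorem exists_quasiIso_of_isStrictlyLE {C : Type*} [Category* C] [Abelian C] [EnoughProjectives C]
    (K : CochainComplex C ℤ) (n : ℤ) [K.IsStrictlyLE n] :
    ∃ (P : CochainComplex C ℤ) (_ : P.IsKProjective) (f : P ⟶ K), QuasiIso f := by
  let E := CochainComplex.opEquivalence C
  have : (E.functor.obj (op K)).IsStrictlyGE (-n) := by
    rw [CochainComplex.isStrictlyGE_iff]
    intro i hi
    exact (K.isZero_of_isStrictlyLE n (-i) (by lia)).op
  obtain ⟨L, i, hi, hL, hL'⟩ :=
    CochainComplex.Plus.modelCategoryQuillen.exists_quasiIso_injective (E.functor.obj (op K)) (-n)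
  have hK := CochainComplex.isKInjective_of_injective L (-n)
  let P := (E.inverse.obj L).unop
  let e : E.functor.obj (op P) ≅ L := E.counitIso.app L
  let f : P ⟶ K := (E.functor.preimage (i ≫ e.inv)).unop
  have hf : E.functor.map f.op = i ≫ e.inv := by simp [f]
  have : QuasiIso (E.functor.map f.op) := by rw [hf]; infer_instance
  refine ⟨P, CochainComplex.isKProjective_of_op
    (CochainComplex.isKInjective_of_iso e.symm), f, ?_⟩
  rw [quasiIso_iff]
  intro m
  obtain ⟨j, rfl⟩ : ∃ j, m = -j := ⟨-m, by simp⟩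
  have h := (quasiIsoAt_iff' (E.functor.map f.op) (j - 1) j (j + 1) (by simp) (by simp)).1
    inferInstance
  rw [quasiIsoAt_iff' f (-(j + 1)) (-j) (-(j - 1)) (by simp; lia) (by simp; lia)]
  exact (ShortComplex.quasiIso_opMap_iff _).1 h

theorem nonempty_kProjectiveResolution (R : Type u) [CommRing R]
    [HasDerivedCategory.{w} (ModuleCat.{u} R)] (X : DerivedCategory (ModuleCat.{u} R))
    (hX : IsHomologicallyBounded R X) : Nonempty (KProjectiveResolution R X) := by
  obtain ⟨a, b, h⟩ := hX
  have hLE : X.IsLE (-a) := by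
    rw [DerivedCategory.isLE_iff]
    intro i hi
    have h' := h (-i) (Or.inl (by lia))
    have := ModuleCat.isZero_of_subsingleton (homol R X (-i))
    simpa only [homol, neg_neg] using this
  obtain ⟨K, hK, ⟨e⟩⟩ := DerivedCategory.exists_iso_Q_obj_of_isLE X (-a)
  obtain ⟨P, hP, f, hf⟩ := exists_quasiIso_of_isStrictlyLE K (-a)
  exact ⟨⟨P, hP, asIso (DerivedCategory.Q.map f) ≪≫ e.symm⟩⟩

/-- A chosen K-projective resolution of a homologically bounded object of `D(R)`. -/
def resolution (R : Type u) [CommRing R]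
    [HasDerivedCategory.{w} (ModuleCat.{u} R)] (X : DerivedCategory (ModuleCat.{u} R))
    (hX : IsHomologicallyBounded R X) : KProjectiveResolution R X :=
  (nonempty_kProjectiveResolution R X hX).some

/-! ### The homothety morphism and semidualizing complexes -/

/-- The complex of `R`-modules `Hom_R(P, Y)`: in cohomological degree `n` it is the module of
families of linear maps `P^p ⟶ Y^{p+n}`, with the usual differential. -/
def homComplex (R : Type u) [CommRing R] (P Y : CochainComplex (ModuleCat.{u} R) ℤ) :
    CochainComplex (ModuleCat.{u} R) ℤ where
  X n := ModuleCat.of R (Cochain P Y n)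
  d i j := ModuleCat.ofHom (δ_hom R P Y i j)
  shape i j hij := ModuleCat.hom_ext (LinearMap.ext fun z => δ_shape i j hij z)
  d_comp_d' i j k _ _ := ModuleCat.hom_ext (LinearMap.ext fun z => δ_δ i j k z)

/-- The homothety `R ⟶ Hom_R(P, P)`, `r ↦ r • id_P`, with `R` a complex concentrated in
degree `0`. -/
def homothety (R : Type u) [CommRing R] (P : CochainComplex (ModuleCat.{u} R) ℤ) :
    (CochainComplex.singleFunctor (ModuleCat.{u} R) 0).obj (ModuleCat.of R R) ⟶
      homComplex R P P :=
  HomologicalComplex.mkHomFromSingle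
    (ModuleCat.ofHom (LinearMap.toSpanSingleton R (Cochain P P 0) (Cochain.ofHom (𝟙 P))))
    (fun k _ => ModuleCat.hom_ext (LinearMap.ext fun r => by
      change δ 0 k (r • Cochain.ofHom (𝟙 P)) = 0
      rw [δ_smul, δ_ofHom, smul_zero]))

/-- `RHom_R(X, X)` in `D(R)`, for `X` homologically bounded. -/
def rEnd (R : Type u) [CommRing R] [HasDerivedCategory.{w} (ModuleCat.{u} R)]
    (X : DerivedCategory (ModuleCat.{u} R)) (hX : IsHomologicallyBounded R X) :
    DerivedCategory (ModuleCat.{u} R) :=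
  DerivedCategory.Q.obj (homComplex R (resolution R X hX).cx (resolution R X hX).cx)

/-- The homothety morphism `R ⟶ RHom_R(X, X)` in `D(R)`. -/
def derivedHomothety (R : Type u) [CommRing R] [HasDerivedCategory.{w} (ModuleCat.{u} R)]
    (X : DerivedCategory (ModuleCat.{u} R)) (hX : IsHomologicallyBounded R X) :
    DerivedCategory.Q.obj
      ((CochainComplex.singleFunctor (ModuleCat.{u} R) 0).obj (ModuleCat.of R R)) ⟶
        rEnd R X hX :=
  DerivedCategory.Q.map (homothety R (resolution R X hX).cx)

/-- A semidualizing complex for `R`: a homologically bounded complex with finitely generated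
homology modules whose homothety morphism `R ⟶ RHom_R(C, C)` is an isomorphism in `D(R)`. -/
structure IsSemidualizing (R : Type u) [CommRing R] [HasDerivedCategory.{w} (ModuleCat.{u} R)]
    (C : DerivedCategory (ModuleCat.{u} R)) : Prop where
  bounded : IsHomologicallyBounded R C
  finite : ∀ i : ℤ, Module.Finite R (homol R C i)
  isIso : IsIso (derivedHomothety R C bounded)

/-! ### Betti numbers -/

instance extendScalars_additive {R S : Type u} [CommRing R] [CommRing S] (f : R →+* S) :
    (ModuleCat.extendScalars.{u, u, u} f).Additive :=
  (ModuleCat.extendRestrictScalarsAdj f).left_adjoint_additive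

/-- `Tor_n^R(k, X) = H_n(k ⊗ᴸ_R X)` as a vector space over the residue field `k` of `R`, for `X`
homologically bounded. -/
def torResidue (R : Type u) [CommRing R] [IsLocalRing R]
    [HasDerivedCategory.{w} (ModuleCat.{u} R)]
    (X : DerivedCategory (ModuleCat.{u} R)) (hX : IsHomologicallyBounded R X) (n : ℤ) :
    ModuleCat.{u} (IsLocalRing.ResidueField R) :=
  (((ModuleCat.extendScalars.{u, u, u} (IsLocalRing.residue R)).mapHomologicalComplex
    (ComplexShape.up ℤ)).obj (resolution R X hX).cx).homology (-n)

/-- The `n`-th Betti number `β_n(X)`, the dimension over `k` of `Tor_n^R(k, X)`. -/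
def betti (R : Type u) [CommRing R] [IsLocalRing R]
    [HasDerivedCategory.{w} (ModuleCat.{u} R)]
    (X : DerivedCategory (ModuleCat.{u} R)) (hX : IsHomologicallyBounded R X) (n : ℤ) : ℕ :=
  Module.finrank (IsLocalRing.ResidueField R) (torResidue R X hX n)

end SemidualizingComplex

end

/-!
Write `k` for the residue field, let `n = sup C` and put `m = -n`, the lowest cohomological degree
in which `C` has cohomology; `Σ^{-m} M` denotes a module `M` placed in cohomological degree `m`.

That `C` is semidualizing means that `Hom(C, C⟦j⟧) = 0` for `j ≠ 0` and `Hom(C, C) = R`; this is all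
that is used (`IsSemidualizing.hom_shift_eq_zero`, `IsSemidualizing.exists_eq_smul_id`,
`IsSemidualizing.eq_zero_of_smul_id_eq_zero`). Three ingredients enter.

* *A torsion-free class.* `H^m(C)` has an element `y` with zero annihilator
  (`exists_torsionFree_element_of_homology`). Otherwise it contains a copy of `R ⧸ p` for a prime
  `p ≠ 0`, hence there is a map `Σ^{-m} R ⧸ p ⟶ C` which is injective on cohomology; as `p`
  supports the cohomology of `C`, there is also a map from `C` to some shift of `R ⧸ p` which is
  nonzero on cohomology, and the composite is a nonzero graded endomorphism of `C` killed by `p`.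
  But the graded endomorphisms form the torsion-free module `R`.

* *The lowest syzygy.* In a minimal free resolution of `C`, the quotient by everything above
  degree `m` leaves a finitely generated module `M`, with `π : C ⟶ Σ^{-m} M` and a map `δ` from
  `M` to a free module such that `H^m(C)` is the kernel of `δ`; by minimality every nonzero map
  from `M` to `k` stays nonzero on `C` (`exists_lowest_syzygy`). Homotopy classes of maps from a
  K-projective resolution of `C` to `Σ^{-m} k` embed into the dual of `H_n(k ⊗ C)`, so if the
  Betti number is `2` then `M` has two generators (`exists_two_generators_of_betti_eq_two`).

* *Two generators.* If `δ = 0`, then `C` splits as `Σ^{-m} M` plus a rest; as `R` has no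
  nontrivial idempotents, `C ≅ Σ^{-m} M`. If `δ ≠ 0`, then a coordinate of `δ` is a nonzero
  functional on `M` killing the image of `y`, which still has zero annihilator, so `M` has rank at
  least `2`; being generated by two elements, it is free and maps onto `R`. If `C` had cohomology
  above `m`, with top degree `i`, then a minimal generator of `H^i(C)` would give a map
  `Σ^{-i} R ⟶ C`, and the composite `C ⟶ Σ^{-m} M ⟶ Σ^{-m} R ⟶ Σ^{i-m} C` would be nonzero, as
  is seen by mapping on to `k`. This contradicts `Hom(C, C⟦i - m⟧) = 0`
  (`IsSemidualizing.isLE_of_surjective`). The two cases are put together in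
  `IsSemidualizing.exists_iso_single`.
-/

/-! ### Truncation triangles and maps to modules in a single degree -/

namespace DerivedCategory

open CategoryTheory Limits Pretriangulated

section Triangulated

variable {T : Type*} [Category* T] [HasZeroObject T] [HasShift T ℤ] [Preadditive T]
  [∀ n : ℤ, (shiftFunctor T n).Additive] [Pretriangulated T]
  {X Y Z W : T} {f : X ⟶ Y} {g : Y ⟶ Z} {h : Z ⟶ X⟦(1 : ℤ)⟧}

lemma distTriang_lift₂ (hT : Triangle.mk f g h ∈ distTriang T) (φ : W ⟶ Y) (hφ : φ ≫ g = 0) :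
    ∃ ψ : W ⟶ X, φ = ψ ≫ f :=
  Triangle.coyoneda_exact₂ _ hT φ hφ

lemma distTriang_lift₃ (hT : Triangle.mk f g h ∈ distTriang T) (φ : W ⟶ Z) (hφ : φ ≫ h = 0) :
    ∃ ψ : W ⟶ Y, φ = ψ ≫ g :=
  Triangle.coyoneda_exact₃ _ hT φ hφ

lemma distTriang_desc₃ (hT : Triangle.mk f g h ∈ distTriang T) (φ : Z ⟶ W) (hφ : g ≫ φ = 0) :
    ∃ ψ : X⟦(1 : ℤ)⟧ ⟶ W, φ = h ≫ ψ :=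
  Triangle.yoneda_exact₃ _ hT φ hφ

/-- The companion of `Triangle.yoneda_exact₂` and `Triangle.yoneda_exact₃` at the first vertex: the
obstruction to extending `φ` along `f` is the composite of `φ⟦1⟧` with `h`. -/
lemma distTriang_desc₁ (hT : Triangle.mk f g h ∈ distTriang T) (φ : X ⟶ W)
    (hφ : h ≫ φ⟦(1 : ℤ)⟧' = 0) : ∃ ψ : Y ⟶ W, φ = f ≫ ψ := by
  obtain ⟨ψ, hψ⟩ : ∃ ψ : Y⟦(1 : ℤ)⟧ ⟶ W⟦(1 : ℤ)⟧, φ⟦(1 : ℤ)⟧' = (-f⟦(1 : ℤ)⟧') ≫ ψ :=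
    Triangle.yoneda_exact₃ _ (rot_of_distTriang _ hT) (φ⟦(1 : ℤ)⟧') hφ
  obtain ⟨ψ, rfl⟩ := (shiftFunctor T (1 : ℤ)).map_surjective ψ
  refine ⟨-ψ, (shiftFunctor T (1 : ℤ)).map_injective ?_⟩
  rw [hψ]
  simp

lemma distTriang_comp₂₃ (hT : Triangle.mk f g h ∈ distTriang T) : g ≫ h = 0 :=
  comp_distTriang_mor_zero₂₃ _ hT

lemma distTriang_comp₃₁ (hT : Triangle.mk f g h ∈ distTriang T) : h ≫ f⟦1⟧' = 0 :=
  comp_distTriang_mor_zero₃₁ _ hT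

end Triangulated

section Abelian

universe w' v' u'

variable {A : Type u'} [Category.{v'} A] [Abelian A] [HasDerivedCategory.{w'} A]

lemma isLE_shift_one (X : DerivedCategory A) (n k : ℤ) (hX : X.IsLE n) (hk : n ≤ k + 1) :
    (X⟦(1 : ℤ)⟧).IsLE k := by
  have : TStructure.t.IsLE (X⟦(1 : ℤ)⟧) (n - 1) := TStructure.t.isLE_shift X n 1 (n - 1)
  exact TStructure.t.isLE_of_le _ (n - 1) k (by lia)

lemma isGE_shift_one (X : DerivedCategory A) (n k : ℤ) (hX : X.IsGE n) (hk : k + 1 ≤ n) :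
    (X⟦(1 : ℤ)⟧).IsGE k := by
  have : TStructure.t.IsGE (X⟦(1 : ℤ)⟧) (n - 1) := TStructure.t.isGE_shift X n 1 (n - 1)
  exact TStructure.t.isGE_of_ge _ k (n - 1) (by lia)

section Triangle

variable {X Y Z : DerivedCategory A} {f : X ⟶ Y} {g : Y ⟶ Z} {h : Z ⟶ X⟦(1 : ℤ)⟧}

lemma isLE₃_of_distTriang (hT : Triangle.mk f g h ∈ distTriang _) (n : ℤ)
    (hX : X.IsLE (n + 1)) (hY : Y.IsLE n) : Z.IsLE n :=
  TStructure.t.isLE₂ _ (rot_of_distTriang _ hT) n hY (isLE_shift_one X (n + 1) n hX le_rfl)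

lemma isGE₁_of_distTriang (hT : Triangle.mk f g h ∈ distTriang _) (n : ℤ)
    (hY : Y.IsGE n) (hZ : Z.IsGE (n - 1)) : X.IsGE n := by
  refine TStructure.t.isGE₂ _ (inv_rot_of_distTriang _ hT) n ?_ hY
  have : TStructure.t.IsGE (Z⟦(-1 : ℤ)⟧) n := TStructure.t.isGE_shift Z (n - 1) (-1) n
  exact this

lemma isGE₃_of_distTriang (hT : Triangle.mk f g h ∈ distTriang _) (n : ℤ)
    (hX : X.IsGE (n + 1)) (hY : Y.IsGE n) : Z.IsGE n :=
  TStructure.t.isGE₂ _ (rot_of_distTriang _ hT) n hY (isGE_shift_one X (n + 1) n hX le_rfl)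

end Triangle

/-- Splitting off the top cohomology. -/
lemma exists_truncation_triangle_of_isLE (X : DerivedCategory A) (n : ℤ) [X.IsLE n] :
    ∃ (X' : DerivedCategory A) (Y : A) (f : X' ⟶ X) (g : X ⟶ (singleFunctor A n).obj Y)
      (h : (singleFunctor A n).obj Y ⟶ X'⟦(1 : ℤ)⟧),
      X'.IsLE (n - 1) ∧ Triangle.mk f g h ∈ distTriang (DerivedCategory A) := by
  obtain ⟨X', Z, hX', hZ, f, g, h, hT⟩ :=
    (TStructure.t (C := A)).exists_triangle X (n - 1) n (by lia)
  have hX1 : X'.IsLE (n - 1) := ⟨hX'⟩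
  have hZ1 : Z.IsGE n := ⟨hZ⟩
  have hZ2 : Z.IsLE n := isLE₃_of_distTriang hT n
    (TStructure.t.isLE_of_le X' (n - 1) (n + 1) (by lia)) inferInstance
  obtain ⟨Y, ⟨e⟩⟩ := exists_iso_singleFunctor_obj_of_isGE_of_isLE Z n
  refine ⟨X', Y, f, g ≫ e.hom, e.inv ≫ h, hX1, isomorphic_distinguished _ hT _ ?_⟩
  exact Triangle.isoMk (Triangle.mk f (g ≫ e.hom) (e.inv ≫ h)) (Triangle.mk f g h)
    (Iso.refl X') (Iso.refl X) e.symm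
    ((Category.comp_id f).trans (Category.id_comp f).symm)
    (show (g ≫ e.hom) ≫ e.inv = 𝟙 X ≫ g by simp)
    (show (e.inv ≫ h) ≫ (𝟙 X')⟦1⟧' = e.inv ≫ h by simp)

/-- Splitting off the lowest cohomology. -/
lemma exists_truncation_triangle_of_isGE (X : DerivedCategory A) (n : ℤ) [X.IsGE n] :
    ∃ (X' : DerivedCategory A) (Y : A) (f : (singleFunctor A n).obj Y ⟶ X) (g : X ⟶ X')
      (h : X' ⟶ ((singleFunctor A n).obj Y)⟦(1 : ℤ)⟧),
      X'.IsGE (n + 1) ∧ Triangle.mk f g h ∈ distTriang (DerivedCategory A) := by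
  obtain ⟨Z, X', hZ, hX', f, g, h, hT⟩ :=
    (TStructure.t (C := A)).exists_triangle X n (n + 1) (by lia)
  have hX1 : X'.IsGE (n + 1) := ⟨hX'⟩
  have hZ1 : Z.IsLE n := ⟨hZ⟩
  have hZ2 : Z.IsGE n := isGE₁_of_distTriang hT n inferInstance
    (TStructure.t.isGE_of_ge X' (n - 1) (n + 1) (by lia))
  obtain ⟨Y, ⟨e⟩⟩ := exists_iso_singleFunctor_obj_of_isGE_of_isLE Z n
  refine ⟨X', Y, e.inv ≫ f, g, h ≫ e.hom⟦1⟧', hX1, isomorphic_distinguished _ hT _ ?_⟩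
  exact Triangle.isoMk (Triangle.mk (e.inv ≫ f) g (h ≫ e.hom⟦1⟧')) (Triangle.mk f g h)
    e.symm (Iso.refl X) (Iso.refl X')
    (show (e.inv ≫ f) ≫ 𝟙 X = e.inv ≫ f by simp)
    (show g ≫ 𝟙 X' = 𝟙 X ≫ g by simp)
    (show (h ≫ e.hom⟦1⟧') ≫ e.inv⟦1⟧' = 𝟙 X' ≫ h by simp [← Functor.map_comp])

/-- The canonical identification of `M` with the cohomology in degree `n` of the complex which
consists of `M` in degree `n`. -/
noncomputable abbrev homologySingleIso (n : ℤ) (M : A) :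
    (homologyFunctor A n).obj ((singleFunctor A n).obj M) ≅ M :=
  (singleFunctorCompHomologyFunctorIso A n).app M

lemma homologyMap_single_comp (n : ℤ) {M N : A} (f : M ⟶ N) :
    (homologyFunctor A n).map ((singleFunctor A n).map f) ≫ (homologySingleIso n N).hom =
      (homologySingleIso n M).hom ≫ f :=
  (singleFunctorCompHomologyFunctorIso A n).hom.naturality f

lemma isIso_homologyMap_of_isLE {X Y Z : DerivedCategory A} {f : X ⟶ Y} {g : Y ⟶ Z}
    {h : Z ⟶ X⟦(1 : ℤ)⟧} (hT : Triangle.mk f g h ∈ distTriang _)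
    (n : ℤ) (hX : X.IsLE (n - 1)) : IsIso ((homologyFunctor A n).map g) := by
  have h1 : IsZero ((homologyFunctor A n).obj X) := isZero_of_isLE _ (n - 1) n (by lia)
  have h2 : IsZero ((homologyFunctor A (n + 1)).obj X) :=
    isZero_of_isLE _ (n - 1) (n + 1) (by lia)
  have : Mono ((homologyFunctor A n).map g) :=
    (HomologySequence.mono_homologyMap_mor₂_iff _ hT n).2 (h1.eq_of_src _ _)
  have : Epi ((homologyFunctor A n).map g) :=
    (HomologySequence.epi_homologyMap_mor₂_iff _ hT n (n + 1)).2 (h2.eq_of_tgt _ _)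
  exact isIso_of_mono_of_epi _

lemma isIso_homologyMap_of_isGE {X Y Z : DerivedCategory A} {f : X ⟶ Y} {g : Y ⟶ Z}
    {h : Z ⟶ X⟦(1 : ℤ)⟧} (hT : Triangle.mk f g h ∈ distTriang _)
    (n : ℤ) (hZ : Z.IsGE (n + 1)) : IsIso ((homologyFunctor A n).map f) := by
  have h1 : IsZero ((homologyFunctor A n).obj Z) := isZero_of_isGE _ (n + 1) n (by lia)
  have h2 : IsZero ((homologyFunctor A (n - 1)).obj Z) :=
    isZero_of_isGE _ (n + 1) (n - 1) (by lia)
  have : Mono ((homologyFunctor A n).map f) :=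
    (HomologySequence.mono_homologyMap_mor₁_iff _ hT (n - 1) n).2 (h2.eq_of_src _ _)
  have : Epi ((homologyFunctor A n).map f) :=
    (HomologySequence.epi_homologyMap_mor₁_iff _ hT n).2 (h1.eq_of_tgt _ _)
  exact isIso_of_mono_of_epi _

/-- A map out of the top cohomology module of `X` is induced by a map out of `X`. -/
lemma exists_hom_single_of_isLE (X : DerivedCategory A) (n : ℤ) [X.IsLE n] {M : A}
    (f : (homologyFunctor A n).obj X ⟶ M) :
    ∃ F : X ⟶ (singleFunctor A n).obj M,
      (homologyFunctor A n).map F ≫ (homologySingleIso n M).hom = f := by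
  obtain ⟨X', Y, i, g, h, hX', hT⟩ := exists_truncation_triangle_of_isLE X n
  have hg : IsIso ((homologyFunctor A n).map g) := isIso_homologyMap_of_isLE hT n hX'
  refine ⟨g ≫ (singleFunctor A n).map
    ((homologySingleIso n Y).inv ≫ inv ((homologyFunctor A n).map g) ≫ f), ?_⟩
  rw [Functor.map_comp, Category.assoc, homologyMap_single_comp]
  simp

/-- A map into the lowest cohomology module of `X` is induced by a map into `X`. -/
lemma exists_single_hom_of_isGE (X : DerivedCategory A) (n : ℤ) [X.IsGE n] {M : A}
    (f : M ⟶ (homologyFunctor A n).obj X) :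
    ∃ F : (singleFunctor A n).obj M ⟶ X,
      (homologyFunctor A n).map F = (homologySingleIso n M).hom ≫ f := by
  obtain ⟨X', Y, i, g, h, hX', hT⟩ := exists_truncation_triangle_of_isGE X n
  have hg : IsIso ((homologyFunctor A n).map i) := isIso_homologyMap_of_isGE hT n hX'
  refine ⟨(singleFunctor A n).map
    (f ≫ inv ((homologyFunctor A n).map i) ≫ (homologySingleIso n Y).hom) ≫ i, ?_⟩
  rw [Functor.map_comp, ← cancel_mono (inv ((homologyFunctor A n).map i) ≫
    (homologySingleIso n Y).hom)]
  simp only [Category.assoc, IsIso.hom_inv_id_assoc]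
  rw [homologyMap_single_comp]

/-- A map between complexes concentrated in degree `n` vanishes if it does so on cohomology. -/
lemma single_hom_eq_zero {n : ℤ} {M N : A}
    (F : (singleFunctor A n).obj M ⟶ (singleFunctor A n).obj N)
    (hF : (homologyFunctor A n).map F = 0) : F = 0 := by
  obtain ⟨f, rfl⟩ := (singleFunctor A n).map_surjective F
  have := homologyMap_single_comp n f
  rw [hF, zero_comp] at this
  rw [show f = 0 by simpa using this.symm, Functor.map_zero]

/-- Extensions of positive degree of a projective object vanish. -/
lemma single_projective_hom_eq_zero {n : ℤ} (P : A) [Projective P] (Y : DerivedCategory A)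
    (hY : Y.IsLE (n - 1)) (f : (singleFunctor A n).obj P ⟶ Y) : f = 0 := by
  obtain ⟨K, hK, ⟨e⟩⟩ := exists_iso_Q_obj_of_isLE Y (n - 1)
  let L : CochainComplex A ℤ := (HomologicalComplex.single A (.up ℤ) n).obj P
  have : ∀ i, Projective (L.X i) := fun i ↦ by
    by_cases hi : i = n
    · subst hi
      exact Projective.of_iso (HomologicalComplex.singleObjXSelf (.up ℤ) i P).symm inferInstance
    · exact (HomologicalComplex.isZero_single_obj_X (.up ℤ) n P i hi).projective
  have : L.IsStrictlyLE n := inferInstanceAs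
    (CochainComplex.IsStrictlyLE ((CochainComplex.singleFunctor A n).obj P) n)
  have := CochainComplex.isKProjective_of_projective L n
  obtain ⟨g, hg⟩ := (CochainComplex.IsKProjective.Qh_map_bijective L _).surjective
    ((quotientCompQhIso A).hom.app L ≫ (f ≫ e.hom : Q.obj L ⟶ Q.obj K) ≫
      (quotientCompQhIso A).inv.app K)
  obtain ⟨g, rfl⟩ := (HomotopyCategory.quotient _ _).map_surjective g
  have hg0 : g = 0 := by
    refine HomologicalComplex.hom_ext _ _ fun i ↦ ?_
    by_cases hi : i = n
    · exact (K.isZero_of_isStrictlyLE (n - 1) i (by lia)).eq_of_tgt _ _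
    · exact (HomologicalComplex.isZero_single_obj_X (.up ℤ) n P i hi).eq_of_src _ _
  rw [hg0, Functor.map_zero, Functor.map_zero] at hg
  have h2 : (f ≫ e.hom : Q.obj L ⟶ Q.obj K) = 0 := by
    rw [← cancel_epi ((quotientCompQhIso A).hom.app L),
      ← cancel_mono ((quotientCompQhIso A).inv.app K), Category.assoc]
    simpa using hg.symm
  rw [← cancel_mono e.hom, zero_comp]
  exact h2

/-- A map from a projective object into the *top* cohomology of `X` is induced by a map into `X`:
it lifts along the projection of `X` to its top cohomology, because the obstruction lies in a
positive extension group of the projective object. -/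
lemma exists_single_projective_hom (X : DerivedCategory A) (n : ℤ) (hX : X.IsLE n)
    {P : A} [Projective P]
    (f : P ⟶ (homologyFunctor A n).obj X) :
    ∃ F : (singleFunctor A n).obj P ⟶ X,
      (homologyFunctor A n).map F = (homologySingleIso n P).hom ≫ f := by
  obtain ⟨X', Y, i, g, h, hX', hT⟩ := exists_truncation_triangle_of_isLE X n
  have hg : IsIso ((homologyFunctor A n).map g) := isIso_homologyMap_of_isLE hT n hX'
  let φ := (singleFunctor A n).map
    (f ≫ (homologyFunctor A n).map g ≫ (homologySingleIso n Y).hom)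
  have hφ : φ ≫ h = 0 := single_projective_hom_eq_zero P _
    (isLE_shift_one X' (n - 1) (n - 1) hX' (by lia)) _
  obtain ⟨F, hF⟩ := distTriang_lift₃ hT φ hφ
  refine ⟨F, ?_⟩
  have h1 := homologyMap_single_comp n
    (f ≫ (homologyFunctor A n).map g ≫ (homologySingleIso n Y).hom)
  change (homologyFunctor A n).map φ ≫ _ = _ at h1
  rw [hF] at h1
  rw [Functor.map_comp] at h1
  rw [← cancel_mono ((homologyFunctor A n).map g), ← cancel_mono (homologySingleIso n Y).hom]
  simpa only [Category.assoc] using h1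

lemma mono_homologyMap_shift {X Y : DerivedCategory A} (f : X ⟶ Y) (n a a' : ℤ) (h : n + a = a')
    (hf : Mono ((homologyFunctor A a').map f)) : Mono ((homologyFunctor A a).map (f⟦n⟧')) := by
  let e : shiftFunctor (DerivedCategory A) n ⋙ homologyFunctor A a ≅ homologyFunctor A a' :=
    (homologyFunctor A 0).shiftIso n a a' h
  have h1 : (homologyFunctor A a).map (f⟦n⟧') =
      e.hom.app X ≫ (homologyFunctor A a').map f ≫ e.inv.app Y := by
    have h2 : (homologyFunctor A a).map (f⟦n⟧') ≫ e.hom.app Y =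
        e.hom.app X ≫ (homologyFunctor A a').map f := e.hom.naturality f
    rw [← Category.assoc, ← h2, Category.assoc, e.hom_inv_id_app]
    exact (Category.comp_id _).symm
  rw [h1]
  infer_instance

end Abelian

end DerivedCategory

/-! ### Modules over local rings and domains -/

namespace Module

open _root_.IsLocalRing TensorProduct

/-- Over a domain, a module generated by two elements is free of rank two as soon as it has rank at
least two; here the lower bound on the rank is witnessed by a nonzero functional together with an
element of its kernel with zero annihilator. Only a surjective functional is recorded. -/
lemma exists_surjective_functional_of_two_generators {R M : Type*} [CommRing R] [IsDomain R]
    [AddCommGroup M] [Module R M] (q : (Fin 2 → R) →ₗ[R] M) (hq : Function.Surjective q)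
    (α : M →ₗ[R] R) (hα : α ≠ 0) (x : M) (hx : α x = 0) (hx' : ∀ r : R, r • x = 0 → r = 0) :
    ∃ ρ : M →ₗ[R] R, Function.Surjective ρ := by
  obtain ⟨w, rfl⟩ := hq x
  have hαq (v : Fin 2 → R) : α (q v) =
      v 0 * α (q (Pi.single 0 1)) + v 1 * α (q (Pi.single 1 1)) := by
    have : v = v 0 • Pi.single 0 1 + v 1 • Pi.single 1 1 := by
      ext i; fin_cases i <;> simp
    conv_lhs => rw [this]
    simp
  have hne : α (q (Pi.single 0 1)) ≠ 0 ∨ α (q (Pi.single 1 1)) ≠ 0 := by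
    by_contra! h
    refine hα (LinearMap.ext fun y ↦ ?_)
    obtain ⟨v, rfl⟩ := hq y
    rw [hαq, h.1, h.2]
    simp
  have hinj : LinearMap.ker q = ⊥ := by
    rw [LinearMap.ker_eq_bot']
    intro v hv
    have h1 : α (q v) = 0 := by rw [hv, map_zero]
    rw [hαq] at hx h1
    -- `v` and `w` lie in the kernel of a nonzero functional on `R ^ 2`, so they are proportional
    have hdet : v 0 * w 1 = v 1 * w 0 := by
      rcases hne with h | h
      · refine mul_right_cancel₀ h ?_
        linear_combination w 1 * h1 - v 1 * hx
      · refine mul_right_cancel₀ h ?_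
        linear_combination v 0 * hx - w 0 * h1
    have key (i : Fin 2) : v i • w = w i • v := by
      ext j
      fin_cases i <;> fin_cases j <;> simp <;>
        first | ring1 | linear_combination hdet | linear_combination -hdet
    ext i
    refine hx' _ ?_
    rw [← map_smul, key, map_smul, hv, smul_zero]
  let e := LinearEquiv.ofBijective q ⟨LinearMap.ker_eq_bot.1 hinj, hq⟩
  exact ⟨LinearMap.proj 0 ∘ₗ e.symm.toLinearMap, fun r ↦ ⟨e (Pi.single 0 r), by simp⟩⟩

section Local

variable {R M : Type*} [CommRing R] [IsLocalRing R] [AddCommGroup M] [Module R M]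
  [Module.Finite R M]

/-- Nakayama's lemma: a basis of `k ⊗ M` lifts to generators of `M`. -/
lemma exists_minimal_generators : ∃ (b : ℕ) (f : Fin b → M)
    (B : Basis (Fin b) (ResidueField R) (ResidueField R ⊗[R] M)),
    (∀ i, (1 : ResidueField R) ⊗ₜ[R] f i = B i) ∧
      Function.Surjective (Fintype.linearCombination R f) := by
  let B := Module.finBasis (ResidueField R) (ResidueField R ⊗[R] M)
  have hs : Function.Surjective (TensorProduct.mk R (ResidueField R) M 1) :=
    TensorProduct.mk_surjective R M (ResidueField R) Ideal.Quotient.mk_surjective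
  choose f hf using fun i ↦ hs (B i)
  refine ⟨_, f, B, hf, ?_⟩
  rw [← LinearMap.range_eq_top, Fintype.range_linearCombination]
  exact IsLocalRing.span_eq_top_of_tmul_eq_basis f B hf

/-- A minimal generating system: functionals on the free cover with values in the residue field
descend to the module. -/
lemma exists_minimal_cover : ∃ (b : ℕ) (q : (Fin b → R) →ₗ[R] M), Function.Surjective q ∧
    ∀ χ : (Fin b → R) →ₗ[R] ResidueField R, ∃ ψ : M →ₗ[R] ResidueField R, ψ ∘ₗ q = χ := by
  obtain ⟨b, f, B, hB, hf⟩ := exists_minimal_generators (R := R) (M := M)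
  refine ⟨b, _, hf, fun χ ↦ ⟨((B.constr ℕ fun i ↦ χ (Pi.single i 1)).restrictScalars R) ∘ₗ
    TensorProduct.mk R (ResidueField R) M 1, ?_⟩⟩
  refine LinearMap.pi_ext' fun i ↦ LinearMap.ext_ring ?_
  simp [Fintype.linearCombination_apply_single, hB]

/-- If `Hom_R(M, k)` has no three linearly independent elements, then `M` has two generators. -/
lemma exists_two_generators
    (h : ∀ χ : Fin 3 → (M →ₗ[R] ResidueField R), ∃ r : Fin 3 → R,
      (∃ i, residue R (r i) ≠ 0) ∧ ∑ i, r i • χ i = 0) :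
    ∃ q : (Fin 2 → R) →ₗ[R] M, Function.Surjective q := by
  obtain ⟨b, f, B, hB, hf⟩ := exists_minimal_generators (R := R) (M := M)
  have hb : b ≤ 2 := by
    by_contra! hb
    let ι : Fin 3 → Fin b := Fin.castLE hb
    obtain ⟨r, ⟨i, hi⟩, hr⟩ := h fun i ↦ ((B.coord (ι i)).restrictScalars R) ∘ₗ
      TensorProduct.mk R (ResidueField R) M 1
    refine hi ?_
    have h1 := LinearMap.congr_fun hr (f (ι i))
    have hinj : ∀ j, (ι i = ι j) ↔ i = j := fun j ↦ (Fin.castLE_injective hb).eq_iff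
    simpa [hB, Finsupp.single_apply, hinj, Algebra.smul_def, ← ResidueField.algebraMap_eq]
      using h1
  let p : (Fin 2 → R) →ₗ[R] (Fin b → R) := LinearMap.funLeft R R (Fin.castLE hb)
  have hp : Function.Surjective p :=
    LinearMap.funLeft_surjective_of_injective R R _ (Fin.castLE_injective hb)
  exact ⟨Fintype.linearCombination R f ∘ₗ p, hf.comp hp⟩

lemma exists_ne_zero_functional_residueField [Nontrivial M] :
    ∃ χ : M →ₗ[R] ResidueField R, χ ≠ 0 := by
  obtain ⟨b, f, B, hB, hf⟩ := exists_minimal_generators (R := R) (M := M)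
  have : Nonempty (Fin b) := by
    by_contra! hb
    have : Subsingleton M := hf.subsingleton
    exact not_subsingleton M this
  obtain ⟨i⟩ := this
  refine ⟨((B.coord i).restrictScalars R) ∘ₗ TensorProduct.mk R (ResidueField R) M 1,
    fun h ↦ ?_⟩
  have h1 := LinearMap.congr_fun h (f i)
  simp [hB] at h1

end Local

/-- A finite module whose localization at the prime `p` is nonzero admits a nonzero map to
`R ⧸ p`. -/
lemma exists_ne_zero_hom_quotient_prime {R M : Type*} [CommRing R] [AddCommGroup M]
    [Module R M] [Module.Finite R M] (p : Ideal R) [hp : p.IsPrime]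
    (h : Module.annihilator R M ≤ p) : ∃ φ : M →ₗ[R] R ⧸ p, φ ≠ 0 := by
  have hs : (⟨p, hp⟩ : PrimeSpectrum R) ∈ Module.support R M :=
    Module.mem_support_iff_of_finite.2 h
  rw [Module.mem_support_iff_nontrivial_residueField_tensorProduct] at hs
  let K := p.ResidueField
  change Nontrivial (K ⊗[R] M) at hs
  let B := Module.finBasis K (K ⊗[R] M)
  have hB : Nonempty (Fin (Module.finrank K (K ⊗[R] M))) :=
    Fin.pos_iff_nonempty.1 Module.finrank_pos
  obtain ⟨i⟩ := hB
  let θ : M →ₗ[R] K := ((B.coord i).restrictScalars R) ∘ₗ TensorProduct.mk R K M 1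
  have hθ : θ ≠ 0 := fun h0 ↦ by
    have : B.coord i = 0 := by
      refine LinearMap.ext fun z ↦ ?_
      induction z using TensorProduct.induction_on with
      | zero => simp
      | add x y hx hy => rw [map_add, hx, hy]; simp
      | tmul a m =>
        have h1 : B.coord i (1 ⊗ₜ m) = 0 := LinearMap.congr_fun h0 m
        rw [show a ⊗ₜ[R] m = a • ((1 : K) ⊗ₜ[R] m) by simp [TensorProduct.smul_tmul'],
          map_smul, h1]
        simp
    have h2 := LinearMap.congr_fun this (B i)
    simp at h2
  -- clear denominators of the images of a finite generating set
  obtain ⟨n, g, hg⟩ := Module.Finite.exists_fin (R := R) (M := M)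
  obtain ⟨d, hd⟩ := IsLocalization.exist_integer_multiples_of_finite
    (nonZeroDivisors (R ⧸ p)) (fun j ↦ θ (g j))
  let ι : (R ⧸ p) →ₗ[R] K := (Algebra.linearMap (R ⧸ p) K).restrictScalars R
  have hι : Function.Injective ι := IsFractionRing.injective (R ⧸ p) K
  let θ' : M →ₗ[R] K := ((LinearMap.lsmul (R ⧸ p) K (d : R ⧸ p)).restrictScalars R) ∘ₗ θ
  have hr : ∀ m, θ' m ∈ LinearMap.range ι := by
    intro m
    have hm : m ∈ Submodule.span R (Set.range g) := hg ▸ Submodule.mem_top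
    have hle : Submodule.span R (Set.range g) ≤ (LinearMap.range ι).comap θ' := by
      rw [Submodule.span_le]
      rintro _ ⟨j, rfl⟩
      obtain ⟨y, hy⟩ := hd j
      exact ⟨y, hy⟩
    exact hle hm
  refine ⟨(LinearEquiv.ofInjective ι hι).symm.toLinearMap ∘ₗ θ'.codRestrict _ hr,
    fun h0 ↦ hθ (LinearMap.ext fun m ↦ ?_)⟩
  have h1 := LinearMap.congr_fun h0 m
  simp only [LinearMap.coe_comp, LinearEquiv.coe_coe, Function.comp_apply, LinearMap.zero_apply,
    LinearEquiv.map_eq_zero_iff] at h1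
  have h2 : (d : R ⧸ p) • θ m = 0 := congrArg Subtype.val h1
  rw [Algebra.smul_def] at h2
  refine (mul_eq_zero.1 h2).resolve_left ?_
  exact IsLocalization.to_map_ne_zero_of_mem_nonZeroDivisors K le_rfl d.2

end Module

/-! ### Torsion-free classes in the lowest cohomology -/

namespace DerivedCategory

open CategoryTheory Limits Pretriangulated

section Module

variable {R : Type u} [CommRing R]

lemma smul_id_eq_zero_of_mem_annihilator (M : ModuleCat.{u} R) (r : R)
    (hr : r ∈ Module.annihilator R M) : r • 𝟙 M = 0 := by
  ext x
  exact Module.mem_annihilator.1 hr x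

lemma mem_annihilator_of_iso {M N : ModuleCat.{u} R} (e : M ≅ N) {r : R}
    (hr : r ∈ Module.annihilator R M) : r ∈ Module.annihilator R N := by
  rwa [← e.toLinearEquiv.annihilator_eq]

variable [HasDerivedCategory.{w} (ModuleCat.{u} R)]

lemma smul_id_single (n : ℤ) (M : ModuleCat.{u} R) (r : R) :
    r • 𝟙 ((singleFunctor (ModuleCat.{u} R) n).obj M) =
      (singleFunctor (ModuleCat.{u} R) n).map (r • 𝟙 M) := by
  rw [Functor.map_smul, CategoryTheory.Functor.map_id]

/-- If the prime `p` lies in the support of the cohomology of `X`, then some map from `X` to a shift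
of `R ⧸ p` is nonzero on cohomology. In the top degree whose cohomology survives localization at `p`
such a map exists after localization; the higher cohomology is killed by an element outside
`p`, and multiplication by this element removes the obstruction to extending the map. -/
lemma exists_hom_single_quotient_prime (p : Ideal R) [p.IsPrime] (k : ℕ) :
    ∀ (X : DerivedCategory (ModuleCat.{u} R)) (j a : ℤ), a = j + k → X.IsLE a →
      (∀ i, Module.Finite R ((homologyFunctor (ModuleCat.{u} R) i).obj X)) →
      Module.annihilator R ((homologyFunctor (ModuleCat.{u} R) j).obj X) ≤ p →
      ∃ (t : ℤ) (φ : X ⟶ (singleFunctor (ModuleCat.{u} R) t).obj (ModuleCat.of R (R ⧸ p))),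
        (homologyFunctor (ModuleCat.{u} R) t).map φ ≠ 0 := by
  have of_top (X : DerivedCategory (ModuleCat.{u} R)) (a : ℤ) (hX : X.IsLE a)
      (hfin : Module.Finite R ((homologyFunctor (ModuleCat.{u} R) a).obj X))
      (ha : Module.annihilator R ((homologyFunctor (ModuleCat.{u} R) a).obj X) ≤ p) :
      ∃ (t : ℤ) (φ : X ⟶ (singleFunctor (ModuleCat.{u} R) t).obj (ModuleCat.of R (R ⧸ p))),
        (homologyFunctor (ModuleCat.{u} R) t).map φ ≠ 0 := by
    obtain ⟨χ, hχ⟩ := Module.exists_ne_zero_hom_quotient_prime p ha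
    obtain ⟨φ, hφ⟩ := exists_hom_single_of_isLE X a (M := ModuleCat.of R (R ⧸ p))
      (ModuleCat.ofHom χ)
    refine ⟨a, φ, fun h0 ↦ hχ ?_⟩
    rw [h0, zero_comp] at hφ
    exact congrArg ModuleCat.Hom.hom hφ.symm
  induction k with
  | zero =>
    intro X j a ha hX hfin hj
    obtain rfl : a = j := by simpa using ha
    exact of_top X a hX (hfin a) hj
  | succ k ih =>
    intro X j a ha hX hfin hj
    by_cases htop : Module.annihilator R ((homologyFunctor (ModuleCat.{u} R) a).obj X) ≤ p
    · exact of_top X a hX (hfin a) htop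
    obtain ⟨g, hg, hgp⟩ := SetLike.not_le_iff_exists.1 htop
    obtain ⟨X', Y, f, π, δ, hX', hT⟩ := exists_truncation_triangle_of_isLE X a
    have hiso (i : ℤ) (hi : i < a) : IsIso ((homologyFunctor (ModuleCat.{u} R) i).map f) :=
      isIso_homologyMap_of_isGE hT i (TStructure.t.isGE_of_ge _ (i + 1) a (by lia))
    have hfin' (i : ℤ) : Module.Finite R ((homologyFunctor (ModuleCat.{u} R) i).obj X') := by
      by_cases hi : i < a
      · have := hiso i hi
        have := hfin i
        exact Module.Finite.equiv
          (asIso ((homologyFunctor (ModuleCat.{u} R) i).map f)).symm.toLinearEquiv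
      · have := ModuleCat.subsingleton_of_isZero (isZero_of_isLE X' (a - 1) i (by lia))
        infer_instance
    have hj' : Module.annihilator R ((homologyFunctor (ModuleCat.{u} R) j).obj X') ≤ p := by
      have := hiso j (by lia)
      exact fun r hr ↦ hj (mem_annihilator_of_iso
        (asIso ((homologyFunctor (ModuleCat.{u} R) j).map f)) hr)
    obtain ⟨t, φ, hφ⟩ := ih X' j (a - 1) (by lia) hX' hfin' hj'
    have hgY : g • δ = 0 := by
      have hπ : IsIso ((homologyFunctor (ModuleCat.{u} R) a).map π) :=
        isIso_homologyMap_of_isLE hT a hX'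
      have hY : g ∈ Module.annihilator R Y := mem_annihilator_of_iso
        (asIso ((homologyFunctor (ModuleCat.{u} R) a).map π) ≪≫ homologySingleIso a Y) hg
      rw [← Category.id_comp δ, ← Linear.smul_comp, smul_id_single,
        smul_id_eq_zero_of_mem_annihilator Y g hY, Functor.map_zero, zero_comp]
    obtain ⟨ψ, hψ⟩ := distTriang_desc₁ hT (g • φ) (by
      rw [Functor.map_smul, Linear.comp_smul, ← Linear.smul_comp, hgY, zero_comp])
    refine ⟨t, ψ, fun h0 ↦ hφ ?_⟩
    have h1 : (homologyFunctor (ModuleCat.{u} R) t).map (g • φ) = 0 := by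
      rw [hψ, Functor.map_comp, h0, comp_zero]
    rw [← Category.comp_id φ, ← Linear.comp_smul, smul_id_single, Functor.map_comp] at h1
    have h2 := congrArg (fun α ↦ α ≫ (homologySingleIso t (ModuleCat.of R (R ⧸ p))).hom) h1
    rw [Category.assoc, homologyMap_single_comp, zero_comp] at h2
    have hmono : Mono (g • 𝟙 (ModuleCat.of R (R ⧸ p))) := by
      rw [ModuleCat.mono_iff_injective]
      intro x y hxy
      change g • x = g • y at hxy
      obtain ⟨x, rfl⟩ := Ideal.Quotient.mk_surjective x
      obtain ⟨y, rfl⟩ := Ideal.Quotient.mk_surjective y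
      rw [← sub_eq_zero, ← smul_sub, ← map_sub, Algebra.smul_def, Ideal.Quotient.algebraMap_eq,
        ← map_mul, Ideal.Quotient.eq_zero_iff_mem] at hxy
      rw [← sub_eq_zero, ← map_sub, Ideal.Quotient.eq_zero_iff_mem]
      exact (Ideal.IsPrime.mem_or_mem ‹_› hxy).resolve_left hgp
    rw [← Category.assoc, ← zero_comp (f := g • 𝟙 (ModuleCat.of R (R ⧸ p))), cancel_mono] at h2
    rw [← cancel_mono (homologySingleIso t (ModuleCat.of R (R ⧸ p))).hom, h2, zero_comp]

/-- If all graded endomorphism modules of `C` are torsion-free, then the lowest cohomology module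
of `C` has an element with zero annihilator. Otherwise it contains `R ⧸ p` for some `p ≠ 0`, and
the composite of a map `C ⟶ Σ^i (R ⧸ p)` which is nonzero on cohomology with
`Σ^i (R ⧸ p) ⟶ Σ^j C` is a nonzero map killed by `p`. -/
lemma exists_torsionFree_element_of_homology [IsNoetherianRing R] [IsDomain R]
    (C : DerivedCategory (ModuleCat.{u} R)) (m b : ℤ) [C.IsGE m] (hb : C.IsLE b)
    (hfin : ∀ i, Module.Finite R ((homologyFunctor (ModuleCat.{u} R) i).obj C))
    (hC : ∀ (j : ℤ) (f : C ⟶ C⟦j⟧) (r : R), r ≠ 0 → r • f = 0 → f = 0)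
    (hm : Nontrivial ((homologyFunctor (ModuleCat.{u} R) m).obj C)) :
    ∃ y : (homologyFunctor (ModuleCat.{u} R) m).obj C, ∀ r : R, r • y = 0 → r = 0 := by
  obtain ⟨p, hp⟩ := associatedPrimes.nonempty R ((homologyFunctor (ModuleCat.{u} R) m).obj C)
  obtain ⟨hprime, ι, hι⟩ := (isAssociatedPrime_iff_exists_injective_linearMap _ _).1 hp
  by_cases hp0 : p = ⊥
  · refine ⟨ι 1, fun r hr ↦ ?_⟩
    rw [← map_smul, map_eq_zero_iff _ hι, Algebra.smul_def, mul_one,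
      Ideal.Quotient.algebraMap_eq, Ideal.Quotient.eq_zero_iff_mem, hp0] at hr
    exact hr
  obtain ⟨r, hrp, hr0⟩ := Submodule.exists_mem_ne_zero_of_ne_bot hp0
  have hmb : m ≤ b := by
    by_contra! h
    exact not_subsingleton _ (ModuleCat.subsingleton_of_isZero (isZero_of_isLE C b m h))
  obtain ⟨t, φ, hφ⟩ := exists_hom_single_quotient_prime p (b - m).toNat C m b (by lia) hb hfin
    (Submodule.annihilator_top (R := R) (M := (homologyFunctor (ModuleCat.{u} R) m).obj C) ▸
      IsAssociatedPrime.annihilator_le hp)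
  obtain ⟨F, hF⟩ := exists_single_hom_of_isGE C m (M := ModuleCat.of R (R ⧸ p))
    (ModuleCat.ofHom ι)
  let e := ((singleFunctors (ModuleCat.{u} R)).shiftIso (m - t) t m (by lia)).app
    (ModuleCat.of R (R ⧸ p))
  have hkill : r • φ = 0 := by
    rw [← Category.comp_id φ, ← Linear.comp_smul, smul_id_single,
      smul_id_eq_zero_of_mem_annihilator, Functor.map_zero, comp_zero]
    exact (Ideal.annihilator_quotient (I := p)).symm ▸ hrp
  have h0 := hC (m - t) (φ ≫ e.inv ≫ F⟦m - t⟧') r hr0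
    (by rw [← Linear.smul_comp, hkill, zero_comp])
  have hFm : Mono ((homologyFunctor (ModuleCat.{u} R) m).map F) := by
    have : Mono (ModuleCat.ofHom ι) := (ModuleCat.mono_iff_injective _).2 hι
    rw [hF]
    exact mono_comp _ _
  have := mono_homologyMap_shift F (m - t) t m (by lia) hFm
  have h1 := congrArg (homologyFunctor (ModuleCat.{u} R) t).map h0
  rw [Functor.map_comp, Functor.map_comp, Functor.map_zero, ← Category.assoc] at h1
  have h2 := (cancel_mono ((homologyFunctor (ModuleCat.{u} R) t).map (F⟦m - t⟧'))).1
    (h1.trans zero_comp.symm)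
  exact absurd ((cancel_mono ((homologyFunctor (ModuleCat.{u} R) t).map e.inv)).1
    (h2.trans zero_comp.symm)) hφ

end Module

end DerivedCategory

/-! ### The lowest syzygy of a complex -/

namespace DerivedCategory

open CategoryTheory Limits Pretriangulated

section Module

variable {R : Type u} [CommRing R]

lemma finite_of_exact [IsNoetherianRing R] {S : ShortComplex (ModuleCat.{u} R)} (hS : S.Exact)
    (h₁ : Module.Finite R S.X₁) (h₃ : Module.Finite R S.X₃) : Module.Finite R S.X₂ := by
  have := isNoetherian_of_range_eq_ker S.f.hom S.g.hom (hS.moduleCat_range_eq_ker)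
  infer_instance

instance projective_pi (b : ℕ) : Projective (ModuleCat.of R (Fin b → R)) :=
  (IsProjective.iff_projective _).1 inferInstance

variable [HasDerivedCategory.{w} (ModuleCat.{u} R)]

/-- A map `π : C ⟶ D` behaves, in the lowest degree `m`, like the quotient of a complex of
projective modules by its part in degrees `> m + 1`: morphisms from a module placed in
degree `m` to `C` and to `D` agree, and no morphism from `D` to such a module dies on `C`. -/
structure IsLowDegreeQuotient (m : ℤ) {C D : DerivedCategory (ModuleCat.{u} R)} (π : C ⟶ D) :
    Prop where
  isGE : D.IsGE m
  finite : ∀ i, Module.Finite R ((homologyFunctor (ModuleCat.{u} R) i).obj D)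
  exists_lift : ∀ {W : ModuleCat.{u} R} (f : (singleFunctor (ModuleCat.{u} R) m).obj W ⟶ D),
    ∃ f', f = f' ≫ π
  eq_zero_of_comp : ∀ {W : ModuleCat.{u} R} (f : (singleFunctor (ModuleCat.{u} R) m).obj W ⟶ C),
    f ≫ π = 0 → f = 0
  eq_zero_of_precomp : ∀ {V : ModuleCat.{u} R}
    (f : D ⟶ (singleFunctor (ModuleCat.{u} R) m).obj V), π ≫ f = 0 → f = 0

lemma finite_homology_single (n : ℤ) (M : ModuleCat.{u} R)
    [Module.Finite R M] (i : ℤ) : Module.Finite R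
      ((homologyFunctor (ModuleCat.{u} R) i).obj ((singleFunctor (ModuleCat.{u} R) n).obj M)) := by
  rcases lt_trichotomy i n with hi | rfl | hi
  · have := ModuleCat.subsingleton_of_isZero
      (isZero_of_isGE ((singleFunctor (ModuleCat.{u} R) n).obj M) n i hi)
    infer_instance
  · exact Module.Finite.equiv (homologySingleIso i M).symm.toLinearEquiv
  · have := ModuleCat.subsingleton_of_isZero
      (isZero_of_isLE ((singleFunctor (ModuleCat.{u} R) n).obj M) n i hi)
    infer_instance

/-- Attaching a cell: an epimorphism from a projective module onto the top cohomology of `D` lifts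
to a map from a shift of this module to `D`. The cone of this map has no cohomology in the top
degree of `D`. -/
lemma exists_triangle_of_cover [IsNoetherianRing R] {D : DerivedCategory (ModuleCat.{u} R)}
    (m j : ℤ) (hmj : m + 1 ≤ j) (hm : D.IsGE m) (hj : D.IsLE j)
    (hfin : ∀ i, Module.Finite R ((homologyFunctor (ModuleCat.{u} R) i).obj D))
    {P : ModuleCat.{u} R} [Projective P] [Module.Finite R P]
    (q : P ⟶ (homologyFunctor (ModuleCat.{u} R) j).obj D) [Epi q] :
    ∃ (D' : DerivedCategory (ModuleCat.{u} R))
      (F : (singleFunctor (ModuleCat.{u} R) j).obj P ⟶ D) (g : D ⟶ D')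
      (h : D' ⟶ ((singleFunctor (ModuleCat.{u} R) j).obj P)⟦(1 : ℤ)⟧),
      Triangle.mk F g h ∈ distTriang _ ∧
      (homologyFunctor (ModuleCat.{u} R) j).map F = (homologySingleIso j P).hom ≫ q ∧
      D'.IsGE m ∧ D'.IsLE (j - 1) ∧
      ∀ i, Module.Finite R ((homologyFunctor (ModuleCat.{u} R) i).obj D') := by
  obtain ⟨F, hF⟩ := exists_single_projective_hom D j hj q
  obtain ⟨D', g, h, hT⟩ := distinguished_cocone_triangle F
  have hle : D'.IsLE j := isLE₃_of_distTriang hT j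
    (TStructure.t.isLE_of_le _ j (j + 1) (by lia)) hj
  refine ⟨D', F, g, h, hT, hF, isGE₃_of_distTriang hT m
    (TStructure.t.isGE_of_ge _ (m + 1) j hmj) hm, ?_, fun i ↦
      finite_of_exact (HomologySequence.exact₃ _ hT i (i + 1) rfl) (hfin i)
        (finite_homology_single j P (i + 1))⟩
  rw [isLE_iff]
  intro i hi
  obtain hi | rfl := lt_or_eq_of_le (show j ≤ i by lia)
  · exact isZero_of_isLE D' j i hi
  have hepi : Epi ((homologyFunctor (ModuleCat.{u} R) j).map F) := by
    rw [hF]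
    exact epi_comp _ _
  have h0 : (homologyFunctor (ModuleCat.{u} R) j).map g = 0 :=
    (HomologySequence.epi_homologyMap_mor₁_iff _ hT j).1 hepi
  have h1 : Epi ((homologyFunctor (ModuleCat.{u} R) j).map g) :=
    (HomologySequence.epi_homologyMap_mor₂_iff _ hT j (j + 1)).2
      ((isZero_of_isLE ((singleFunctor (ModuleCat.{u} R) j).obj P) j (j + 1)
        (by lia)).eq_of_tgt _ _)
  exact IsZero.of_epi_eq_zero _ h0

/-- The shift of a module placed in degree `j` is this module placed in degree `j - 1`. -/
noncomputable abbrev singleShiftOneIso (i j : ℤ) (h : 1 + i = j) (P : ModuleCat.{u} R) :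
    ((singleFunctor (ModuleCat.{u} R) j).obj P)⟦(1 : ℤ)⟧ ≅
      (singleFunctor (ModuleCat.{u} R) i).obj P :=
  ((singleFunctors (ModuleCat.{u} R)).shiftIso 1 i j h).app P

/-- Killing the top cohomology of `D`, in a degree `j ≥ m + 2`, by attaching free cells. -/
lemma IsLowDegreeQuotient.exists_next [IsNoetherianRing R] {m j : ℤ} (hmj : m + 2 ≤ j)
    {C D : DerivedCategory (ModuleCat.{u} R)} {π : C ⟶ D} (hπ : IsLowDegreeQuotient m π)
    (hD : D.IsLE j) :
    ∃ (D' : DerivedCategory (ModuleCat.{u} R)) (π' : C ⟶ D'),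
      IsLowDegreeQuotient m π' ∧ D'.IsLE (j - 1) := by
  have := hπ.finite j
  obtain ⟨b, q, hq⟩ :=
    Module.Finite.exists_fin' R ((homologyFunctor (ModuleCat.{u} R) j).obj D)
  have : Epi (ModuleCat.ofHom q) := (ModuleCat.epi_iff_surjective _).2 hq
  obtain ⟨D', F, g, h, hT, -, hge, hle, hfin⟩ :=
    exists_triangle_of_cover m j (by lia) hπ.isGE hD hπ.finite (ModuleCat.ofHom q)
  refine ⟨D', π ≫ g, ⟨hge, hfin, fun f ↦ ?_, fun f hf ↦ ?_, fun f hf ↦ ?_⟩, hle⟩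
  · have := isGE_shift_one ((singleFunctor (ModuleCat.{u} R) j).obj
      (ModuleCat.of R (Fin b → R))) j (m + 1) inferInstance (by lia)
    obtain ⟨ψ, rfl⟩ := distTriang_lift₃ hT f (TStructure.t.zero _ m (m + 1))
    obtain ⟨f', rfl⟩ := hπ.exists_lift ψ
    exact ⟨f', Category.assoc _ _ _⟩
  · obtain ⟨ψ, hψ⟩ := distTriang_lift₂ hT (f ≫ π) (by simpa using hf)
    refine hπ.eq_zero_of_comp f ?_
    rw [hψ, TStructure.t.zero ψ m j, zero_comp]
  · obtain ⟨ψ, rfl⟩ := distTriang_desc₃ hT f (hπ.eq_zero_of_precomp _ (by simpa using hf))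
    have h0 : (singleShiftOneIso (j - 1) j (by lia) _).inv ≫ ψ = 0 :=
      single_projective_hom_eq_zero _ _ (TStructure.t.isLE_of_le _ m (j - 1 - 1) (by lia)) _
    rw [(cancel_epi (singleShiftOneIso (j - 1) j (by lia) _).inv).1 (h0.trans comp_zero.symm),
      comp_zero]

lemma exists_isLowDegreeQuotient [IsNoetherianRing R] (m : ℤ) (k : ℕ)
    (C : DerivedCategory (ModuleCat.{u} R)) (hm : C.IsGE m) (hk : C.IsLE (m + 1 + k))
    (hfin : ∀ i, Module.Finite R ((homologyFunctor (ModuleCat.{u} R) i).obj C)) :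
    ∃ (D : DerivedCategory (ModuleCat.{u} R)) (π : C ⟶ D),
      IsLowDegreeQuotient m π ∧ D.IsLE (m + 1) := by
  have aux (i : ℕ) (hi : i ≤ k) : ∃ (D : DerivedCategory (ModuleCat.{u} R)) (π : C ⟶ D),
      IsLowDegreeQuotient m π ∧ D.IsLE (m + 1 + k - i) := by
    induction i with
    | zero =>
      refine ⟨C, 𝟙 C, ⟨hm, hfin, fun f ↦ ⟨f, by simp⟩, fun f hf ↦ by simpa using hf,
        fun f hf ↦ by simpa using hf⟩, by simpa using hk⟩
    | succ i ih =>
      obtain ⟨D, π, hπ, hD⟩ := ih (by lia)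
      obtain ⟨D', π', hπ', hD'⟩ := hπ.exists_next (by lia) hD
      refine ⟨D', π', hπ', ?_⟩
      have h : m + 1 + k - i - 1 = m + 1 + k - (i + 1 : ℕ) := by push_cast; ring
      rwa [h] at hD'
  obtain ⟨D, π, hπ, hD⟩ := aux k le_rfl
  exact ⟨D, π, hπ, by simpa using hD⟩

/-- The lowest syzygy module. Represent `C` by a complex `F` of finite free modules, bounded above
and minimal in low degrees. As `C` has no cohomology below `m`, it is isomorphic to the complex
`0 ⟶ M ⟶ F^(m+1) ⟶ F^(m+2) ⟶ ⋯`, where `M` is the cokernel of `F^(m-1) ⟶ F^m`. Here `M` is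
obtained from `C` by killing all cohomology above `m`, from the top down, with cells that are free
modules. The cells in degrees above `m + 1` are invisible to maps to and from modules in degree
`m`; the cells in degree `m + 1` form the free module `R ^ c = F^(m+1)`, the target of `δ`. They are
chosen minimally, which is what keeps `Hom(M, k) ⟶ Hom(C, Σ^{-m} k)` injective. -/
lemma exists_lowest_syzygy [IsNoetherianRing R] [IsLocalRing R] (m b : ℤ)
    (C : DerivedCategory (ModuleCat.{u} R)) (hm : C.IsGE m) (hb : C.IsLE b)
    (hfin : ∀ i, Module.Finite R ((homologyFunctor (ModuleCat.{u} R) i).obj C)) :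
    ∃ (M : ModuleCat.{u} R) (c : ℕ) (π : C ⟶ (singleFunctor (ModuleCat.{u} R) m).obj M)
      (δ : M ⟶ ModuleCat.of R (Fin c → R)), Module.Finite R M ∧
      (∀ f : M ⟶ ModuleCat.of R (IsLocalRing.ResidueField R),
        π ≫ (singleFunctor (ModuleCat.{u} R) m).map f = 0 → f = 0) ∧
      (∀ {W : ModuleCat.{u} R} (f : W ⟶ M), f ≫ δ = 0 →
        ∃ f', (singleFunctor (ModuleCat.{u} R) m).map f = f' ≫ π) ∧
      (∀ {W : ModuleCat.{u} R} (f : (singleFunctor (ModuleCat.{u} R) m).obj W ⟶ C),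
        f ≫ π = 0 → f = 0) ∧
      π ≫ (singleFunctor (ModuleCat.{u} R) m).map δ = 0 := by
  obtain ⟨D, π, hπ, hD⟩ := exists_isLowDegreeQuotient m (b - m - 1).toNat C hm
    (TStructure.t.isLE_of_le C b _ (by lia)) hfin
  have := hπ.finite (m + 1)
  obtain ⟨c, q, hq, hmin⟩ := Module.exists_minimal_cover (R := R)
    (M := (homologyFunctor (ModuleCat.{u} R) (m + 1)).obj D)
  have : Epi (ModuleCat.ofHom q) := (ModuleCat.epi_iff_surjective _).2 hq
  obtain ⟨D', F, g, h, hT, hF, hge, hle, hfin'⟩ :=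
    exists_triangle_of_cover m (m + 1) le_rfl hπ.isGE hD hπ.finite (ModuleCat.ofHom q)
  have hle' : D'.IsLE m := by simpa using hle
  obtain ⟨M, ⟨e⟩⟩ := exists_iso_singleFunctor_obj_of_isGE_of_isLE D' m
  let s := singleShiftOneIso m (m + 1) (by lia) (ModuleCat.of R (Fin c → R))
  obtain ⟨δ, hδ⟩ := (singleFunctor (ModuleCat.{u} R) m).map_surjective (e.inv ≫ h ≫ s.hom)
  refine ⟨M, c, π ≫ g ≫ e.hom, δ, ?_, fun f hf ↦ ?_, fun f hf ↦ ?_, fun f hf ↦ ?_, ?_⟩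
  · have := hfin' m
    exact Module.Finite.equiv ((homologyFunctor (ModuleCat.{u} R) m).mapIso e ≪≫
      homologySingleIso m M).toLinearEquiv
  · -- by minimality, maps from `Σ^{-m-1} P` to the residue field extend to `D`
    have h1 : g ≫ e.hom ≫ (singleFunctor (ModuleCat.{u} R) m).map f = 0 :=
      hπ.eq_zero_of_precomp _ (by simpa using hf)
    obtain ⟨ψ, hψ⟩ := distTriang_desc₃ hT _ h1
    let s' := singleShiftOneIso m (m + 1) (by lia)
      (ModuleCat.of R (IsLocalRing.ResidueField R))
    obtain ⟨χ', hχ'⟩ := (shiftFunctor (DerivedCategory (ModuleCat.{u} R)) (1 : ℤ)).map_surjective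
      (ψ ≫ s'.inv)
    obtain ⟨χ, rfl⟩ := (singleFunctor (ModuleCat.{u} R) (m + 1)).map_surjective χ'
    obtain ⟨ψ₀, hψ₀⟩ := hmin χ.hom
    obtain ⟨θ, hθ⟩ := exists_hom_single_of_isLE D (m + 1)
      (M := ModuleCat.of R (IsLocalRing.ResidueField R)) (ModuleCat.ofHom ψ₀)
    have hFθ : F ≫ θ = (singleFunctor (ModuleCat.{u} R) (m + 1)).map χ := by
      rw [← sub_eq_zero]
      refine single_hom_eq_zero _ ?_
      rw [Functor.map_sub, sub_eq_zero, ← cancel_mono (homologySingleIso (m + 1)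
        (ModuleCat.of R (IsLocalRing.ResidueField R))).hom, homologyMap_single_comp,
        Functor.map_comp, Category.assoc, hθ, hF, Category.assoc]
      congr 1
      ext1
      exact hψ₀
    have h2 : h ≫ ψ = 0 := by
      rw [← cancel_mono s'.inv, Category.assoc, ← hχ', ← hFθ, Functor.map_comp,
        ← Category.assoc, distTriang_comp₃₁ hT, zero_comp, zero_comp]
    rw [h2] at hψ
    refine (singleFunctor (ModuleCat.{u} R) m).map_injective ?_
    rw [← cancel_epi e.hom, hψ, Functor.map_zero, comp_zero]
  · obtain ⟨ψ, hψ⟩ := distTriang_lift₃ hT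
      ((singleFunctor (ModuleCat.{u} R) m).map f ≫ e.inv) (by
        rw [← cancel_mono s.hom, zero_comp, Category.assoc, Category.assoc, ← hδ,
          ← Functor.map_comp, hf, Functor.map_zero])
    obtain ⟨f', rfl⟩ := hπ.exists_lift ψ
    refine ⟨f', ?_⟩
    rw [← cancel_mono e.inv, hψ]
    simp
  · obtain ⟨ψ, hψ⟩ := distTriang_lift₂ hT (f ≫ π) (by
      rw [← cancel_mono e.hom, zero_comp]
      simpa using hf)
    refine hπ.eq_zero_of_comp f ?_
    rw [hψ, TStructure.t.zero ψ m (m + 1), zero_comp]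
  · rw [hδ]
    simp only [Category.assoc, Iso.hom_inv_id_assoc]
    rw [← Category.assoc g h, distTriang_comp₂₃ hT, zero_comp, comp_zero]

end Module

end DerivedCategory

/-! ### Maps out of K-projective complexes -/

namespace CochainComplex

open CategoryTheory Limits Pretriangulated

section ModuleCat

variable {R : Type u} [CommRing R] {K L : CochainComplex (ModuleCat.{u} R) ℤ}

lemma exists_cycles_eq (K : CochainComplex (ModuleCat.{u} R) ℤ) (j k : ℤ) (hjk : j + 1 = k)
    (z : K.X j) (hz : K.d j k z = 0) : ∃ z' : K.cycles j, K.iCycles j z' = z := by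
  have h : ModuleCat.ofHom (LinearMap.toSpanSingleton R (K.X j) z) ≫ K.d j k = 0 := by
    ext
    simpa using hz
  refine ⟨K.liftCycles _ k (by simp [hjk]) h (1 : R), ?_⟩
  exact (ConcreteCategory.congr_hom (K.liftCycles_i _ k (by simp [hjk]) h) (1 : R)).trans
    (one_smul R z)

lemma exists_eq_toCycles (K : CochainComplex (ModuleCat.{u} R) ℤ) (i j : ℤ) (hij : i + 1 = j)
    (z : K.cycles j) (hz : K.homologyπ j z = 0) : ∃ y : K.X i, K.toCycles i j y = z := by
  have hex : (ShortComplex.mk (K.toCycles i j) (K.homologyπ j)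
      (K.toCycles_comp_homologyπ i j)).Exact :=
    ShortComplex.exact_of_g_is_cokernel _ (K.homologyIsCokernel i j (by simp [← hij]))
  rw [ShortComplex.moduleCat_exact_iff] at hex
  exact hex z hz

lemma iCycles_injective (K : CochainComplex (ModuleCat.{u} R) ℤ) (j : ℤ) :
    Function.Injective (K.iCycles j) :=
  (ModuleCat.mono_iff_injective _).1 inferInstance

/-- Surjectivity on cohomology, in terms of elements. -/
lemma exists_eq_map_add_d (f : K ⟶ L) (i j k : ℤ) (hij : i + 1 = j) (hjk : j + 1 = k)
    [QuasiIsoAt f j] (z : L.X j) (hz : L.d j k z = 0) :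
    ∃ (s : K.X j) (y : L.X i), z = f.f j s + L.d i j y := by
  obtain ⟨z, rfl⟩ := exists_cycles_eq L j k hjk z hz
  have hsurj : Function.Surjective (HomologicalComplex.homologyMap f j) :=
    (ModuleCat.epi_iff_surjective _).1 inferInstance
  have hπ : Function.Surjective (K.homologyπ j) :=
    (ModuleCat.epi_iff_surjective _).1 inferInstance
  obtain ⟨x, hx⟩ := hsurj (L.homologyπ j z)
  obtain ⟨s, rfl⟩ := hπ x
  have h1 : L.homologyπ j (HomologicalComplex.cyclesMap f j s) =
      HomologicalComplex.homologyMap f j (K.homologyπ j s) :=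
    (ConcreteCategory.congr_hom (HomologicalComplex.homologyπ_naturality f j) s).symm
  obtain ⟨y, hy⟩ := exists_eq_toCycles L i j hij (z - HomologicalComplex.cyclesMap f j s) (by
    rw [map_sub, h1, hx, sub_self])
  refine ⟨K.iCycles j s, y, ?_⟩
  have h2 : L.iCycles j (L.toCycles i j y) = L.d i j y :=
    ConcreteCategory.congr_hom (L.toCycles_i i j) y
  have h3 : L.iCycles j (HomologicalComplex.cyclesMap f j s) = f.f j (K.iCycles j s) :=
    ConcreteCategory.congr_hom (HomologicalComplex.cyclesMap_i f j) s
  rw [← h2, hy, map_sub, h3]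
  abel

/-- Injectivity on cohomology, in terms of elements. -/
lemma exists_eq_d_of_map_eq_d (f : K ⟶ L) (i j k : ℤ) (hij : i + 1 = j) (hjk : j + 1 = k)
    [QuasiIsoAt f j] (s : K.X j) (hs : K.d j k s = 0) (y : L.X i) (hy : f.f j s = L.d i j y) :
    ∃ x : K.X i, s = K.d i j x := by
  obtain ⟨s, rfl⟩ := exists_cycles_eq K j k hjk s hs
  have hinj : Function.Injective (HomologicalComplex.homologyMap f j) :=
    (ModuleCat.mono_iff_injective _).1 inferInstance
  have h1 : L.homologyπ j (HomologicalComplex.cyclesMap f j s) =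
      HomologicalComplex.homologyMap f j (K.homologyπ j s) :=
    (ConcreteCategory.congr_hom (HomologicalComplex.homologyπ_naturality f j) s).symm
  have h2 : L.iCycles j (L.toCycles i j y) = L.d i j y :=
    ConcreteCategory.congr_hom (L.toCycles_i i j) y
  have h3 : L.iCycles j (HomologicalComplex.cyclesMap f j s) = f.f j (K.iCycles j s) :=
    ConcreteCategory.congr_hom (HomologicalComplex.cyclesMap_i f j) s
  have h4 : L.toCycles i j y = HomologicalComplex.cyclesMap f j s :=
    iCycles_injective L j (by rw [h2, h3, hy])
  have h5 : L.homologyπ j (L.toCycles i j y) = 0 :=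
    ConcreteCategory.congr_hom (L.toCycles_comp_homologyπ i j) y
  obtain ⟨x, hx⟩ := exists_eq_toCycles K i j hij s (hinj (by rw [← h1, ← h4, h5, map_zero]))
  refine ⟨x, ?_⟩
  rw [← hx]
  exact ConcreteCategory.congr_hom (K.toCycles_i i j) x

end ModuleCat

section KProjective

universe w' v' u'

open DerivedCategory

variable {A : Type u'} [Category.{v'} A] [Abelian A] [HasDerivedCategory.{w'} A]
  (K L : CochainComplex A ℤ)

lemma exists_Q_map_eq_of_isKProjective [K.IsKProjective] (f : Q.obj K ⟶ Q.obj L) :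
    ∃ g : K ⟶ L, Q.map g = f := by
  obtain ⟨g, hg⟩ := (IsKProjective.Qh_map_bijective K _).surjective
    ((quotientCompQhIso A).hom.app K ≫ f ≫ (quotientCompQhIso A).inv.app L)
  obtain ⟨g, rfl⟩ := (HomotopyCategory.quotient _ _).map_surjective g
  refine ⟨g, ?_⟩
  have h := quotientCompQhIso_hom_naturality g
  rw [hg] at h
  rw [← cancel_epi ((quotientCompQhIso A).hom.app K), ← h]
  simp

variable {K L}

lemma Q_map_eq_zero_iff_of_isKProjective [K.IsKProjective] (g : K ⟶ L) :
    Q.map g = 0 ↔ (HomotopyCategory.quotient A (.up ℤ)).map g = 0 := by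
  have h := quotientCompQhIso_hom_naturality g
  constructor
  · intro h0
    rw [h0, comp_zero] at h
    refine (IsKProjective.Qh_map_bijective K _).injective ?_
    rw [Functor.map_zero]
    exact (cancel_mono ((quotientCompQhIso A).hom.app L)).1 (h.trans zero_comp.symm)
  · intro h0
    rw [h0, Functor.map_zero, zero_comp] at h
    exact (cancel_epi ((quotientCompQhIso A).hom.app K)).1 (h.symm.trans comp_zero.symm)

end KProjective

end CochainComplex

/-! ### Endomorphisms of a semidualizing complex -/

namespace SemidualizingComplex

open CategoryTheory Limits Pretriangulated

open DerivedCategory CochainComplex CochainComplex.HomComplex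

section Homothety

variable {R : Type u} [CommRing R] (P : CochainComplex (ModuleCat.{u} R) ℤ)

lemma homothety_f_zero
    (s : ((CochainComplex.singleFunctor (ModuleCat.{u} R) 0).obj (ModuleCat.of R R)).X 0) :
    (homothety R P).f 0 s =
      (HomologicalComplex.singleObjXSelf (.up ℤ) 0 (ModuleCat.of R R)).hom.hom s •
        Cochain.ofHom (𝟙 P) :=
  ConcreteCategory.congr_hom (HomologicalComplex.mkHomFromSingle_f
    (K := homComplex R P P)
    (ModuleCat.ofHom (LinearMap.toSpanSingleton R (Cochain P P 0) (Cochain.ofHom (𝟙 P))))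
    (fun k _ => ModuleCat.hom_ext (LinearMap.ext fun r => by
      change δ 0 k (r • Cochain.ofHom (𝟙 P)) = 0
      rw [δ_smul, δ_ofHom, smul_zero]))) s

variable [QuasiIso (homothety R P)]

lemma exists_eq_δ_of_ne_zero (n : ℤ) (hn : n ≠ 0) (z : Cochain P P n)
    (hz : δ n (n + 1) z = 0) : ∃ β : Cochain P P (n - 1), z = δ (n - 1) n β := by
  obtain ⟨s, y, hy⟩ := exists_eq_map_add_d (homothety R P) (n - 1) n (n + 1) (by lia) rfl z hz
  have : Subsingleton
      (((CochainComplex.singleFunctor (ModuleCat.{u} R) 0).obj (ModuleCat.of R R)).X n) :=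
    ModuleCat.subsingleton_of_isZero (HomologicalComplex.isZero_single_obj_X (.up ℤ) 0 _ n hn)
  rw [Subsingleton.elim s 0, map_zero, zero_add] at hy
  exact ⟨y, hy⟩

lemma exists_eq_smul_id_add_δ (z : Cochain P P 0) (hz : δ 0 1 z = 0) :
    ∃ (r : R) (β : Cochain P P (-1)), z = r • Cochain.ofHom (𝟙 P) + δ (-1) 0 β := by
  obtain ⟨s, y, hy⟩ := exists_eq_map_add_d (homothety R P) (-1) 0 1 (by lia) (by lia) z hz
  rw [homothety_f_zero] at hy
  exact ⟨_, y, hy⟩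

lemma eq_zero_of_smul_id_eq_δ (r : R) (β : Cochain P P (-1))
    (h : r • Cochain.ofHom (𝟙 P) = δ (-1) 0 β) : r = 0 := by
  let e := HomologicalComplex.singleObjXSelf (.up ℤ) 0 (ModuleCat.of R R)
  obtain ⟨s, hs⟩ : ∃ s : ((CochainComplex.singleFunctor (ModuleCat.{u} R) 0).obj
      (ModuleCat.of R R)).X 0, e.hom.hom s = r :=
    ⟨e.inv.hom r, ConcreteCategory.congr_hom e.inv_hom_id r⟩
  have hd : ((CochainComplex.singleFunctor (ModuleCat.{u} R) 0).obj
      (ModuleCat.of R R)).d 0 1 = 0 :=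
    (HomologicalComplex.isZero_single_obj_X (.up ℤ) 0 (ModuleCat.of R R) 1
      (by simp)).eq_of_tgt _ _
  obtain ⟨x, hx⟩ := exists_eq_d_of_map_eq_d (homothety R P) (-1) 0 1 (by lia) (by lia)
    s (by rw [hd]; rfl) β
    ((homothety_f_zero P s).trans ((congrArg (· • Cochain.ofHom (𝟙 P)) hs).trans h))
  have : Subsingleton
      (((CochainComplex.singleFunctor (ModuleCat.{u} R) 0).obj (ModuleCat.of R R)).X (-1)) :=
    ModuleCat.subsingleton_of_isZero (HomologicalComplex.isZero_single_obj_X (.up ℤ) 0 _ _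
      (by simp))
  rw [Subsingleton.elim x 0, map_zero] at hx
  exact hs.symm.trans ((congrArg e.hom.hom hx).trans (map_zero _))

end Homothety

variable {R : Type u} [CommRing R] [HasDerivedCategory.{w} (ModuleCat.{u} R)]
  {C : DerivedCategory (ModuleCat.{u} R)} (hC : IsSemidualizing R C)

include hC

lemma IsSemidualizing.quasiIso_homothety :
    QuasiIso (homothety R (resolution R C hC.bounded).cx) :=
  (isIso_Q_map_iff_quasiIso _ _).1 hC.isIso

/-- The cohomology of `Hom(P, P)` in degree `n` computes `Hom(C, C⟦n⟧)`, so it vanishes for `n ≠ 0`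
because the homothety is a quasi-isomorphism. -/
lemma IsSemidualizing.hom_shift_eq_zero (n : ℤ) (hn : n ≠ 0) (f : C ⟶ C⟦n⟧) : f = 0 := by
  have := hC.quasiIso_homothety
  have := (resolution R C hC.bounded).isKProjective
  set P := (resolution R C hC.bounded).cx
  let e : Q.obj P ≅ C := (resolution R C hC.bounded).iso
  obtain ⟨g, hg⟩ := exists_Q_map_eq_of_isKProjective P (P⟦n⟧)
    (e.hom ≫ f ≫ e.inv⟦n⟧' ≫ (Q.commShiftIso n).inv.app P)
  obtain ⟨β, hβ⟩ := exists_eq_δ_of_ne_zero P n hn (Cocycle.equivHomShift g).1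
    ((Cocycle.equivHomShift g).δ_eq_zero _)
  have h0 : Q.map g = 0 := by
    rw [Q_map_eq_zero_iff_of_isKProjective]
    have h1 := (CohomologyClass.toHom_mk_eq_zero_iff (Cocycle.equivHomShift g)).2
      ((mem_coboundaries_iff _ (n - 1) (by lia)).2 ⟨β, hβ.symm⟩)
    rwa [CohomologyClass.toHom_mk, AddEquiv.symm_apply_apply] at h1
  rw [h0] at hg
  have h2 : f ≫ e.inv⟦n⟧' ≫ (Q.commShiftIso n).inv.app P = 0 := by
    rw [← cancel_epi e.hom, comp_zero, ← hg]
  exact (cancel_mono (e.inv⟦n⟧' ≫ (Q.commShiftIso n).inv.app P)).1 (h2.trans zero_comp.symm)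

lemma IsSemidualizing.exists_eq_smul_id (f : C ⟶ C) : ∃ r : R, f = r • 𝟙 C := by
  have := hC.quasiIso_homothety
  have := (resolution R C hC.bounded).isKProjective
  set P := (resolution R C hC.bounded).cx
  let e : Q.obj P ≅ C := (resolution R C hC.bounded).iso
  obtain ⟨g, hg⟩ := exists_Q_map_eq_of_isKProjective P P (e.hom ≫ f ≫ e.inv)
  obtain ⟨r, β, hβ⟩ := exists_eq_smul_id_add_δ P (Cochain.ofHom g) (by simp)
  have h : Homotopy g (r • 𝟙 P) := (Cochain.equivHomotopy _ _).symm ⟨β, by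
    rw [hβ, add_comm]
    congr 1
    ext
    simp⟩
  have h1 : e.hom ≫ f ≫ e.inv = r • 𝟙 (Q.obj P) := by
    rw [← hg, Q_map_eq_of_homotopy _ h, Functor.map_smul, CategoryTheory.Functor.map_id]
  refine ⟨r, ?_⟩
  rw [← cancel_epi e.hom, ← cancel_mono e.inv, Category.assoc, h1]
  simp

lemma IsSemidualizing.eq_zero_of_smul_id_eq_zero (r : R) (hr : r • 𝟙 C = 0) : r = 0 := by
  have := hC.quasiIso_homothety
  have := (resolution R C hC.bounded).isKProjective
  set P := (resolution R C hC.bounded).cx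
  let e : Q.obj P ≅ C := (resolution R C hC.bounded).iso
  have h0 : Q.map (r • 𝟙 P) = 0 := by
    rw [Functor.map_smul, CategoryTheory.Functor.map_id, ← e.hom_inv_id, ← Category.id_comp e.inv,
      ← Linear.comp_smul, ← Linear.smul_comp, hr, zero_comp, comp_zero]
  rw [Q_map_eq_zero_iff_of_isKProjective, HomotopyCategory.quotient_map_eq_zero_iff] at h0
  obtain ⟨β, hβ⟩ := Cochain.equivHomotopy _ _ h0.some
  refine eq_zero_of_smul_id_eq_δ P r β ?_
  rw [Cochain.ofHom_zero, add_zero] at hβ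
  rw [← hβ]
  ext
  simp

/-- Over a domain, the graded endomorphism modules of a semidualizing complex are
torsion-free. -/
lemma IsSemidualizing.hom_shift_torsionFree [IsDomain R] (n : ℤ) (f : C ⟶ C⟦n⟧) (r : R)
    (hr : r ≠ 0) (hf : r • f = 0) : f = 0 := by
  by_cases hn : n = 0
  · subst hn
    let e := (shiftFunctorZero (DerivedCategory (ModuleCat.{u} R)) ℤ).app C
    obtain ⟨s, hs⟩ := hC.exists_eq_smul_id (f ≫ e.hom)
    have h1 : r * s = 0 := hC.eq_zero_of_smul_id_eq_zero _ (by
      rw [mul_smul, ← hs, ← Linear.smul_comp, hf, zero_comp])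
    rw [(mul_eq_zero.1 h1).resolve_left hr, zero_smul] at hs
    exact (cancel_mono e.hom).1 (hs.trans zero_comp.symm)
  · exact hC.hom_shift_eq_zero n hn f

end SemidualizingComplex

/-! ### Maps to the residue field and the Betti number -/

namespace CochainComplex

open CategoryTheory Limits Pretriangulated

open HomComplex

/-- A chain map to a complex concentrated in degree `m` is null-homotopic as soon as its component
in degree `m` extends along the differential. -/
lemma quotient_map_eq_zero_of_factor {A : Type*} [Category* A] [Abelian A]
    {K : CochainComplex A ℤ} {X : A} {m : ℤ} (g : K ⟶ (singleFunctor A m).obj X)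
    (b : K.X (m + 1) ⟶ X)
    (hb : g.f m ≫ (HomologicalComplex.singleObjXSelf (.up ℤ) m X).hom = K.d m (m + 1) ≫ b) :
    (HomotopyCategory.quotient A (.up ℤ)).map g = 0 := by
  rw [HomotopyCategory.quotient_map_eq_zero_iff]
  refine ⟨(Cochain.equivHomotopy _ _).symm
    ⟨Cochain.toSingleMk b (show m + 1 + (-1) = m by lia), ?_⟩⟩
  rw [Cochain.δ_toSingleMk b _ 0 m (by lia), ← hb, Cochain.ofHom_zero, add_zero]
  refine (Cochain.toSingleEquiv (add_zero m)).injective ?_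
  simp only [Cochain.toSingleEquiv, AddEquiv.coe_mk, Equiv.coe_fn_mk, Cochain.ofHom_v,
    Int.negOnePow_zero, one_smul, Cochain.toSingleMk_v]
  exact ((Category.assoc _ _ _).trans ((congrArg (_ ≫ ·)
    (HomologicalComplex.singleObjXSelf (.up ℤ) m X).inv_hom_id).trans (Category.comp_id _))).symm

/-- A map from `K ^ m` modulo boundaries to an injective object which vanishes on cohomology
factors through the differential: `K ^ m / Z ^ m` embeds into `K ^ (m + 1)`. -/
lemma exists_factor_d_of_homologyι_comp_eq_zero {A : Type*} [Category* A] [Abelian A]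
    (K : CochainComplex A ℤ) {V : A} [Injective V] (m : ℤ)
    (φ : K.opcycles m ⟶ V) (hφ : K.homologyι m ≫ φ = 0) :
    ∃ b : K.X (m + 1) ⟶ V, K.pOpcycles m ≫ φ = K.d m (m + 1) ≫ b := by
  have hex : (ShortComplex.mk (K.homologyι m) (K.fromOpcycles m (m + 1))
      (K.homologyι_comp_fromOpcycles m (m + 1))).Exact :=
    ShortComplex.exact_of_f_is_kernel _ (K.homologyIsKernel m (m + 1) (by simp))
  refine ⟨hex.descToInjective φ hφ, ?_⟩
  have h := hex.comp_descToInjective φ hφ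
  dsimp only at h
  conv_lhs => rw [← h]
  rw [← Category.assoc, K.p_fromOpcycles]

end CochainComplex

namespace SemidualizingComplex

open CategoryTheory Limits Pretriangulated

open DerivedCategory IsLocalRing

variable {R : Type u} [CommRing R] [IsLocalRing R]

/-- The residue field as an `R`-module is the restriction of scalars of its regular module. -/
noncomputable def residueFieldIso : ModuleCat.of R (ResidueField R) ≅
    (ModuleCat.restrictScalars.{u} (residue R)).obj
      (ModuleCat.of (ResidueField R) (ResidueField R)) :=
  LinearEquiv.toModuleIso
    { AddEquiv.refl (ResidueField R) with
      map_smul' := fun r x ↦ Algebra.smul_def r x }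

/-- Extension of scalars to the residue field is left adjoint to restriction of scalars. -/
noncomputable abbrev residueAdjunction :=
  ModuleCat.extendRestrictScalarsAdj.{u, u, u} (residue R)

instance : Injective (ModuleCat.of (ResidueField R) (ResidueField R)) :=
  have : Module.Injective (ResidueField R) (ResidueField R) :=
    Module.injective_of_isSemisimpleRing _ _
  Module.injective_object_of_injective_module (ResidueField R) (ResidueField R)

/-- If `H^m (k ⊗ P)` has dimension at most two, then any three chain maps from `P` to the residue
field `k` in degree `m` satisfy a nontrivial linear relation up to homotopy. Indeed homotopy
classes of such maps embed into the dual of `H^m (k ⊗ P)`. -/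
lemma exists_relation_of_finrank_le_two (P : CochainComplex (ModuleCat.{u} R) ℤ) (m : ℤ)
    (hfin : Module.Finite (ResidueField R) ((((ModuleCat.extendScalars.{u, u, u}
      (residue R)).mapHomologicalComplex (ComplexShape.up ℤ)).obj P).homology m))
    (hrank : Module.finrank (ResidueField R) ((((ModuleCat.extendScalars.{u, u, u}
      (residue R)).mapHomologicalComplex (ComplexShape.up ℤ)).obj P).homology m) ≤ 2)
    (g : Fin 3 → (P ⟶ (CochainComplex.singleFunctor (ModuleCat.{u} R) m).obj
      (ModuleCat.of R (ResidueField R)))) :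
    ∃ r : Fin 3 → R, (∃ i, residue R (r i) ≠ 0) ∧
      (HomotopyCategory.quotient (ModuleCat.{u} R) (.up ℤ)).map (∑ i, r i • g i) = 0 := by
  set K := ((ModuleCat.extendScalars.{u, u, u} (residue R)).mapHomologicalComplex
    (ComplexShape.up ℤ)).obj P
  let k := ModuleCat.of (ResidueField R) (ResidueField R)
  let σ := HomologicalComplex.singleObjXSelf (.up ℤ) m (ModuleCat.of R (ResidueField R))
  let f (i : Fin 3) : P.X m ⟶ ModuleCat.of R (ResidueField R) := (g i).f m ≫ σ.hom
  have hf (i : Fin 3) : P.d (m - 1) m ≫ f i = 0 := by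
    have h := (g i).comm (m - 1) m
    have h0 : (g i).f (m - 1) = 0 :=
      (HomologicalComplex.isZero_single_obj_X (.up ℤ) m (ModuleCat.of R (ResidueField R)) (m - 1)
        (by lia)).eq_of_tgt _ _
    rw [h0, zero_comp] at h
    exact (Category.assoc _ _ _).symm.trans ((congrArg (· ≫ σ.hom) h.symm).trans zero_comp)
  let F (i : Fin 3) : K.X m ⟶ k :=
    (residueAdjunction.homEquiv (P.X m) k).symm (f i ≫ residueFieldIso.hom)
  have hF (i : Fin 3) : K.d (m - 1) m ≫ F i = 0 := by
    have h := residueAdjunction.homEquiv_naturality_left_symm (P.d (m - 1) m)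
      (f i ≫ residueFieldIso.hom)
    rw [← Category.assoc, hf, zero_comp] at h
    refine h.symm.trans ?_
    exact (residueAdjunction.homAddEquiv (P.X (m - 1)) k).symm.map_zero
  let φ (i : Fin 3) : K.opcycles m ⟶ k := K.descOpcycles (F i) (m - 1) (by simp) (hF i)
  let Λ (i : Fin 3) : Module.Dual (ResidueField R) (K.homology m) := (K.homologyι m ≫ φ i).hom
  -- the maps induced by the `g i` on `H ^ m (k ⊗ P)` are dependent in its dual
  have hΛ : ¬ LinearIndependent (ResidueField R) Λ := fun h ↦ by
    have := h.fintype_card_le_finrank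
    rw [Subspace.dual_finrank_eq, Fintype.card_fin] at this
    lia
  obtain ⟨a, ha, ha'⟩ := Fintype.not_linearIndependent_iff.1 hΛ
  choose r hr using fun i ↦ residue_surjective (a i)
  refine ⟨r, by simpa [hr] using ha', ?_⟩
  obtain ⟨b, hb⟩ := CochainComplex.exists_factor_d_of_homologyι_comp_eq_zero K m
    (∑ i, a i • φ i) (by
    ext1
    simpa [Λ, Preadditive.comp_sum] using ha)
  have hb' : ∑ i, a i • F i = K.d m (m + 1) ≫ b := by
    rw [← hb]
    simp [Preadditive.comp_sum, φ]
  let b₀ := (residueAdjunction.homEquiv (P.X (m + 1)) k) b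
  refine CochainComplex.quotient_map_eq_zero_of_factor _ (b₀ ≫ residueFieldIso.inv) ?_
  have hsmul (c : R) (G : K.X m ⟶ k) :
      residueAdjunction.homEquiv (P.X m) k (residue R c • G) =
        c • residueAdjunction.homEquiv (P.X m) k G := rfl
  have hsum : ∑ i, r i • (f i ≫ residueFieldIso.hom) = P.d m (m + 1) ≫ b₀ := by
    have h := residueAdjunction.homEquiv_naturality_left (P.d m (m + 1)) b
    refine Eq.trans ?_ h
    refine Eq.trans ?_ (congrArg (residueAdjunction.homAddEquiv (P.X m) k) hb')
    refine Eq.trans ?_ (map_sum (residueAdjunction.homAddEquiv (P.X m) k) _ _).symm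
    refine Finset.sum_congr rfl fun i _ ↦ ?_
    change _ = residueAdjunction.homEquiv (P.X m) k _
    rw [← hr, hsmul, Equiv.apply_symm_apply]
  rw [← Category.assoc, ← hsum, Preadditive.sum_comp]
  simp only [Linear.smul_comp, Category.assoc, Iso.hom_inv_id, Category.comp_id]
  have h1 : (∑ i, r i • g i).f m = ∑ i, r i • (g i).f m := by
    simp only [Fin.sum_univ_three, HomologicalComplex.add_f_apply, HomologicalComplex.smul_f_apply]
  rw [h1]
  exact (Preadditive.sum_comp _ _ _).trans
    (Finset.sum_congr rfl fun i _ ↦ Linear.smul_comp _ _ _ _ _ _)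

end SemidualizingComplex

/-! ### Amplitude zero -/

namespace SemidualizingComplex

open CategoryTheory Limits Pretriangulated

open DerivedCategory IsLocalRing

variable {R : Type u} [CommRing R] [HasDerivedCategory.{w} (ModuleCat.{u} R)]
  {C : DerivedCategory (ModuleCat.{u} R)}

lemma isGE_of_homolSup_eq {n : ℤ} (hn : homolSup R C = ((n : ℝ) : EReal)) : C.IsGE (-n) := by
  rw [isGE_iff]
  intro i hi
  by_contra hz
  have hnt : Nontrivial (homol R C (-i)) := by
    by_contra h
    rw [not_nontrivial_iff_subsingleton] at h
    refine hz ?_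
    have := ModuleCat.isZero_of_subsingleton (homol R C (-i))
    simpa only [homol, neg_neg] using this
  have h : (((-i : ℤ) : ℝ) : EReal) ≤ ((n : ℝ) : EReal) := hn ▸ le_sSup ⟨-i, hnt, rfl⟩
  rw [EReal.coe_le_coe_iff, Int.cast_le] at h
  lia

lemma nontrivial_homol_of_homolSup_eq {n : ℤ} (hn : homolSup R C = ((n : ℝ) : EReal)) :
    Nontrivial (homol R C n) := by
  by_contra h0
  have h : homolSup R C ≤ (((n - 1 : ℤ) : ℝ) : EReal) := by
    refine sSup_le ?_
    rintro _ ⟨i, hi, rfl⟩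
    have h : ((i : ℝ) : EReal) ≤ ((n : ℝ) : EReal) := hn ▸ le_sSup ⟨i, hi, rfl⟩
    rw [EReal.coe_le_coe_iff, Int.cast_le] at h ⊢
    have : i ≠ n := fun h ↦ h0 (h ▸ hi)
    lia
  rw [hn, EReal.coe_le_coe_iff, Int.cast_le] at h
  lia

lemma amp_eq_zero_of_iso_single {n : ℤ} {M : ModuleCat.{u} R}
    (e : C ≅ (singleFunctor (ModuleCat.{u} R) (-n)).obj M) (h : Nontrivial (homol R C n)) :
    amp R C = 0 := by
  have hset : {x : EReal | ∃ i : ℤ, Nontrivial (homol R C i) ∧ x = ((i : ℝ) : EReal)} =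
      {((n : ℝ) : EReal)} := by
    ext x
    simp only [Set.mem_ofPred_eq, Set.mem_singleton_iff]
    refine ⟨?_, fun hx ↦ ⟨n, h, hx⟩⟩
    rintro ⟨i, hi, rfl⟩
    by_contra hne
    have hin : i ≠ n := fun h ↦ hne (by rw [h])
    refine not_subsingleton_iff_nontrivial.2 hi (ModuleCat.subsingleton_of_isZero
      (IsZero.of_iso ?_ ((homologyFunctor (ModuleCat.{u} R) (-i)).mapIso e)))
    rcases lt_or_gt_of_ne hin with hi | hi
    · exact isZero_of_isLE _ (-n) (-i) (by lia)
    · exact isZero_of_isGE _ (-n) (-i) (by lia)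
  rw [amp, homolSup, homolInf, hset, sSup_singleton, sInf_singleton]
  exact EReal.sub_self (EReal.coe_ne_top _) (EReal.coe_ne_bot _)

/-- If `β_n(C) = 2` and maps from `M` to the residue field are detected by a map from `C` to `M`
placed in homological degree `n`, then `M` has two generators. -/
lemma exists_two_generators_of_betti_eq_two [IsLocalRing R] (hC : IsHomologicallyBounded R C)
    (n : ℤ) (hβ : betti R C hC n = 2) {M : ModuleCat.{u} R} [Module.Finite R M]
    (π : C ⟶ (singleFunctor (ModuleCat.{u} R) (-n)).obj M)
    (hπ : ∀ f : M ⟶ ModuleCat.of R (ResidueField R),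
      π ≫ (singleFunctor (ModuleCat.{u} R) (-n)).map f = 0 → f = 0) :
    ∃ q : (Fin 2 → R) →ₗ[R] M, Function.Surjective q := by
  have hfin : Module.Finite (ResidueField R) (torResidue R C hC n) :=
    Module.finite_of_finrank_pos (by change 0 < betti R C hC n; lia)
  have := (resolution R C hC).isKProjective
  refine Module.exists_two_generators fun χ ↦ ?_
  choose g hg using fun i ↦ CochainComplex.exists_Q_map_eq_of_isKProjective
    (resolution R C hC).cx ((CochainComplex.singleFunctor (ModuleCat.{u} R) (-n)).obj
      (ModuleCat.of R (ResidueField R))) ((resolution R C hC).iso.hom ≫ π ≫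
        (singleFunctor (ModuleCat.{u} R) (-n)).map (ModuleCat.ofHom (χ i)))
  obtain ⟨r, hr, h⟩ := exists_relation_of_finrank_le_two (resolution R C hC).cx (-n) hfin
    hβ.le g
  refine ⟨r, hr, ?_⟩
  rw [← CochainComplex.Q_map_eq_zero_iff_of_isKProjective] at h
  have h1 : (resolution R C hC).iso.hom ≫ π ≫ (singleFunctor (ModuleCat.{u} R) (-n)).map
      (ModuleCat.ofHom (∑ i, r i • χ i)) = 0 := by
    refine Eq.trans ?_ h
    have : ModuleCat.ofHom (∑ i, r i • χ i) = ∑ i, r i • ModuleCat.ofHom (χ i) := by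
      ext
      simp
    rw [this, Functor.map_sum, Functor.map_sum, Preadditive.comp_sum, Preadditive.comp_sum]
    refine Finset.sum_congr rfl fun i _ ↦ ?_
    rw [Functor.map_smul, Functor.map_smul, hg, Linear.comp_smul, Linear.comp_smul]
    rfl
  exact congrArg ModuleCat.Hom.hom (hπ (ModuleCat.ofHom (∑ i, r i • χ i))
    ((cancel_epi (resolution R C hC).iso.hom).1 (h1.trans comp_zero.symm)))

/-- A nonzero split epimorphism from a semidualizing complex is an isomorphism: the idempotent
endomorphism is multiplication by an idempotent of the domain `R`. -/
lemma IsSemidualizing.isIso_of_section [IsDomain R] (hC : IsSemidualizing R C)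
    {D : DerivedCategory (ModuleCat.{u} R)} (π : C ⟶ D) (σ : D ⟶ C) (h : σ ≫ π = 𝟙 D)
    (hπ : π ≠ 0) : IsIso π := by
  obtain ⟨r, hr⟩ := hC.exists_eq_smul_id (π ≫ σ)
  have h1 : r • π = π := by
    have : (π ≫ σ) ≫ π = π := by rw [Category.assoc, h, Category.comp_id]
    rwa [hr, Linear.smul_comp, Category.id_comp] at this
  have h2 : (r * r - r) • 𝟙 C = 0 := by
    rw [sub_smul, mul_smul, ← hr, sub_eq_zero, ← Linear.smul_comp, h1]
  have h3 : r * (r - 1) = 0 := by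
    rw [← hC.eq_zero_of_smul_id_eq_zero _ h2]
    ring
  rcases mul_eq_zero.1 h3 with h0 | h0
  · rw [h0, zero_smul] at h1
    exact absurd h1.symm hπ
  · rw [sub_eq_zero.1 h0, one_smul] at hr
    exact ⟨σ, hr, h⟩

/-- Suppose that `π` maps `C` to a module `M` in degree `m`, that every nonzero map from `M` to the
residue field stays nonzero after composition with `π`, and that `M` maps onto `R`. Then `C` has
no cohomology above `m`: a minimal generator of the top cohomology, in a degree `i > m`, would give
a nonzero map `C ⟶ Σ^{-m} M ⟶ Σ^{-m} R ⟶ Σ^{i-m} C`. -/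
lemma IsSemidualizing.isLE_of_surjective [IsLocalRing R] [IsNoetherianRing R]
    (hC : IsSemidualizing R C) (m b : ℤ) (hb : C.IsLE b)
    (hfin : ∀ i, Module.Finite R ((homologyFunctor (ModuleCat.{u} R) i).obj C))
    {M : ModuleCat.{u} R} (π : C ⟶ (singleFunctor (ModuleCat.{u} R) m).obj M)
    (hπ : ∀ f : M ⟶ ModuleCat.of R (ResidueField R),
      π ≫ (singleFunctor (ModuleCat.{u} R) m).map f = 0 → f = 0)
    (ρ : M →ₗ[R] R) (hρ : Function.Surjective ρ) : C.IsLE m := by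
  rw [isLE_iff]
  by_contra! hne
  obtain ⟨i₀, hi₀, hi₀'⟩ := hne
  obtain ⟨i, ⟨him, hi⟩, hmax⟩ := Int.exists_greatest_of_bdd
    (P := fun i ↦ m < i ∧ ¬ IsZero ((homologyFunctor (ModuleCat.{u} R) i).obj C))
    ⟨b, fun z hz ↦ by
      by_contra! hbz
      exact hz.2 (isZero_of_isLE C b z hbz)⟩ ⟨i₀, hi₀, hi₀'⟩
  have hCi : C.IsLE i := by
    rw [isLE_iff]
    intro j hj
    by_contra hz
    have := hmax j ⟨by lia, hz⟩
    lia
  have : Nontrivial ((homologyFunctor (ModuleCat.{u} R) i).obj C) := by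
    rw [← not_subsingleton_iff_nontrivial]
    intro h
    exact hi (ModuleCat.isZero_of_subsingleton _)
  obtain ⟨χ, hχ⟩ := Module.exists_ne_zero_functional_residueField (R := R)
    (M := (homologyFunctor (ModuleCat.{u} R) i).obj C)
  obtain ⟨x, hx⟩ := DFunLike.exists_ne hχ
  let ξ : ModuleCat.of R R ⟶ (homologyFunctor (ModuleCat.{u} R) i).obj C :=
    ModuleCat.ofHom (LinearMap.toSpanSingleton R _ x)
  let ν : ModuleCat.of R R ⟶ ModuleCat.of R (ResidueField R) := ξ ≫ ModuleCat.ofHom χ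
  have hν : ν ≠ 0 := fun h ↦ hx (by
    have := ConcreteCategory.congr_hom h (1 : R)
    simpa [ν, ξ] using this)
  have : Projective (ModuleCat.of R R) := (IsProjective.iff_projective _).1 inferInstance
  obtain ⟨θ, hθ⟩ := exists_hom_single_of_isLE C i
    (M := ModuleCat.of R (ResidueField R)) (ModuleCat.ofHom χ)
  obtain ⟨X, hX⟩ := exists_single_projective_hom C i hCi ξ
  have hXθ : X ≫ θ = (singleFunctor (ModuleCat.{u} R) i).map ν := by
    rw [← sub_eq_zero]
    refine single_hom_eq_zero _ ?_
    rw [Functor.map_sub, sub_eq_zero, ← cancel_mono (homologySingleIso i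
      (ModuleCat.of R (IsLocalRing.ResidueField R))).hom, homologyMap_single_comp,
      Functor.map_comp, Category.assoc, hθ, hX, Category.assoc]
  -- the nonzero shift `i - m` kills the composite `C ⟶ Σ^{-m} M ⟶ Σ^{-m} R ⟶ Σ^{i-m} C`
  let e := (singleFunctors (ModuleCat.{u} R)).shiftIso (i - m) m i (by lia)
  have h0 := hC.hom_shift_eq_zero (i - m) (by lia)
    (π ≫ (singleFunctor (ModuleCat.{u} R) m).map (ModuleCat.ofHom ρ) ≫
      e.inv.app (ModuleCat.of R R) ≫ X⟦i - m⟧')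
  have hnat : e.inv.app (ModuleCat.of R R) ≫
      ((singleFunctor (ModuleCat.{u} R) i).map ν)⟦i - m⟧' =
        (singleFunctor (ModuleCat.{u} R) m).map ν ≫ e.inv.app _ := (e.inv.naturality ν).symm
  have h1 : π ≫ (singleFunctor (ModuleCat.{u} R) m).map (ModuleCat.ofHom ρ ≫ ν) = 0 := by
    rw [← cancel_mono (e.inv.app _), zero_comp, Functor.map_comp, Category.assoc, Category.assoc,
      ← hnat, ← hXθ, Functor.map_comp]
    have := congrArg (· ≫ θ⟦i - m⟧') h0
    simpa using this
  have : Epi (ModuleCat.ofHom ρ) := (ModuleCat.epi_iff_surjective _).2 hρ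
  exact hν ((cancel_epi (ModuleCat.ofHom ρ)).1 ((hπ _ h1).trans comp_zero.symm))

/-- A semidualizing complex with lowest Betti number `2` is a shifted module. Let `M` be the lowest
syzygy of `C`, with its map `δ` to a free module. If `δ = 0`, then `M` splits off from `C`.
Otherwise `M` has rank at least two, as a coordinate of `δ` kills the torsion-free class `x` that
comes from the lowest cohomology of `C`; having two generators, `M` is free, and
`isLE_of_surjective` applies. -/
lemma IsSemidualizing.exists_iso_single [IsLocalRing R] [IsNoetherianRing R] [IsDomain R]
    (hC : IsSemidualizing R C) (n : ℤ) [C.IsGE (-n)] (hn : Nontrivial (homol R C n))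
    (hβ : betti R C hC.bounded n = 2) :
    ∃ M : ModuleCat.{u} R, Nonempty (C ≅ (singleFunctor (ModuleCat.{u} R) (-n)).obj M) := by
  have hfin (i : ℤ) : Module.Finite R ((homologyFunctor (ModuleCat.{u} R) i).obj C) := by
    obtain ⟨j, rfl⟩ : ∃ j, i = -j := ⟨-i, (neg_neg i).symm⟩
    exact hC.finite j
  obtain ⟨b, hb⟩ : ∃ b, C.IsLE b := by
    obtain ⟨a, _, h⟩ := hC.bounded
    refine ⟨-a, (isLE_iff _ _).2 fun i hi ↦ ?_⟩
    have h' := h (-i) (Or.inl (by lia))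
    have := ModuleCat.isZero_of_subsingleton (homol R C (-i))
    simpa only [homol, neg_neg] using this
  obtain ⟨y, hy⟩ := exists_torsionFree_element_of_homology C (-n) b hb hfin
    (fun j f r hr hf ↦ hC.hom_shift_torsionFree j f r hr hf) hn
  obtain ⟨M, c, π, δ, hM, hdet, hlift, hinj, hδ⟩ :=
    exists_lowest_syzygy (-n) b C inferInstance hb hfin
  obtain ⟨q, hq⟩ := exists_two_generators_of_betti_eq_two hC.bounded n hβ π hdet
  obtain ⟨Y, hY⟩ := exists_single_hom_of_isGE C (-n) (M := ModuleCat.of R R)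
    (ModuleCat.ofHom (LinearMap.toSpanSingleton R _ y))
  -- the element of `M` corresponding to `Y ≫ π` has zero annihilator
  have hYr (r : R) (h : r • (Y ≫ π) = 0) : r = 0 := by
    have h1 : r • Y = 0 := hinj _ (by rw [Linear.smul_comp, h])
    have h2 : (homologyFunctor (ModuleCat.{u} R) (-n)).map
        ((r • 𝟙 ((singleFunctor (ModuleCat.{u} R) (-n)).obj (ModuleCat.of R R))) ≫ Y) = 0 := by
      rw [Linear.smul_comp, Category.id_comp, h1, Functor.map_zero]
    rw [smul_id_single, Functor.map_comp, hY, ← Category.assoc, homologyMap_single_comp,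
      Category.assoc] at h2
    have h3 := (cancel_epi (homologySingleIso (-n) (ModuleCat.of R R)).hom).1
      (h2.trans comp_zero.symm)
    refine hy r ?_
    have h4 : (r • (1 : R)) • y = 0 := ConcreteCategory.congr_hom h3 (1 : R)
    rwa [smul_eq_mul, mul_one] at h4
  by_cases hδ0 : δ = 0
  · obtain ⟨σ, hσ⟩ := hlift (𝟙 M) (by rw [hδ0, comp_zero])
    have := hC.isIso_of_section π σ (by rw [← hσ, CategoryTheory.Functor.map_id])
      (fun h ↦ one_ne_zero (hYr 1 (by rw [h, comp_zero, smul_zero])))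
    exact ⟨M, ⟨asIso π⟩⟩
  · obtain ⟨x, hx⟩ := (singleFunctor (ModuleCat.{u} R) (-n)).map_surjective (Y ≫ π)
    obtain ⟨z, hz⟩ := DFunLike.exists_ne (f := δ.hom) (g := 0)
      (fun h ↦ hδ0 (ModuleCat.hom_ext h))
    obtain ⟨t, ht⟩ := Function.ne_iff.1 hz
    have hxδ : x ≫ δ = 0 := (singleFunctor (ModuleCat.{u} R) (-n)).map_injective (by
      rw [Functor.map_comp, hx, Category.assoc, hδ, comp_zero, Functor.map_zero])
    obtain ⟨ρ, hρ⟩ := Module.exists_surjective_functional_of_two_generators q hq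
      (LinearMap.proj t ∘ₗ δ.hom) (fun h ↦ ht (LinearMap.congr_fun h z)) (x (1 : R))
      (congrFun (ConcreteCategory.congr_hom hxδ (1 : R)) t) (fun r hr ↦ hYr r (by
        have : r • x = 0 := ModuleCat.hom_ext (LinearMap.ext_ring hr)
        rw [← hx, ← Functor.map_smul, this, Functor.map_zero]))
    have := hC.isLE_of_surjective (-n) b hb hfin π hdet ρ hρ
    exact exists_iso_singleFunctor_obj_of_isGE_of_isLE C (-n)

end SemidualizingComplex

open CategoryTheory SemidualizingComplex in
theorem theorem2p12 {R : Type u} [CommRing R] [IsNoetherianRing R] [IsLocalRing R] [IsDomain R]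
    [HasDerivedCategory.{w} (ModuleCat.{u} R)]
    (C : DerivedCategory (ModuleCat.{u} R)) (hC : IsSemidualizing R C)
    (n : ℤ) (hn : homolSup R C = ((n : ℝ) : EReal)) (hβ : betti R C hC.bounded n = 2) :
    amp R C = 0 ∧
      ∃ M : ModuleCat.{u} R, Nonempty
        (C ≅ ((DerivedCategory.singleFunctor (ModuleCat.{u} R) 0).obj M)⟦n⟧) := by
  have := isGE_of_homolSup_eq hn
  have hnt := nontrivial_homol_of_homolSup_eq hn
  obtain ⟨M, ⟨e⟩⟩ := hC.exists_iso_single n hnt hβ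
  exact ⟨amp_eq_zero_of_iso_single e hnt, M, ⟨e ≪≫
    (((DerivedCategory.singleFunctors (ModuleCat.{u} R)).shiftIso n (-n) 0 (by lia)).app M).symm⟩⟩
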